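/- There is a universal constant $C > 0$ such that the following holds for every dimension $d$ and every $\epsilon > 0$. There is a number of copies $n \le C\,d/\epsilon$, depending only on $d$ and $\epsilon$, such that for every fixed (known) mixed state $\sigma \in \mathbb{C}^{d\times d}$ there is a two-outcome measurement (POVM) $\{E_{\mathrm{close}}, E_{\mathrm{far}}\}$ on $(\mathbb{C}^d)^{\otimes n}$, depending on $\sigma$ and $\epsilon$ but not on $\rho$, with the following guarantee for every mixed state $\rho \in \mathbb{C}^{d \times d}$, where the outcome $i$ has probability $\operatorname{tr}(\rho^{\otimes n} E_i)$ when the measurement is applied to $\rho^{\otimes n}$: - if $\rho = \sigma$, then the outcome is "close" with probability at least $2/3$; - if $F(\rho,\sigma) < 1-\epsilon$, then the outcome is "far" with probability at least $2/3$. Here a mixed state is a positive semidefinite matrix of trace $1$, and $F(\rho,\sigma) = \|\sqrt{\rho}\sqrt{\sigma}\|_1$ is the (non-squared) fidelity, where $\|A\|_1 = \operatorname{tr}\sqrt{A^\dagger A}$. -/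

import Mathlib

open scoped MatrixOrder ComplexOrder

noncomputable section

namespace QuantumCert

variable {ι : Type*} [Fintype ι] [DecidableEq ι]

/-- A (mixed) quantum state: a positive semidefinite complex matrix of trace one. -/
structure IsState (ρ : Matrix ι ι ℂ) : Prop where
  posSemidef : ρ.PosSemidef
  trace_eq_one : ρ.trace = 1

/-- The trace norm `‖A‖₁ = tr √(A† A)`. The trace is that of a positive semidefinite matrix, so it
is real and nonnegative. -/
def traceNorm (A : Matrix ι ι ℂ) : ℝ :=
  (CFC.sqrt (A.conjTranspose * A)).trace.re

/-- The (non-squared) fidelity `F(ρ, σ) = ‖√ρ √σ‖₁`. -/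
def fidelity (ρ σ : Matrix ι ι ℂ) : ℝ :=
  traceNorm (CFC.sqrt ρ * CFC.sqrt σ)

/-- A positive-operator valued measurement with outcomes in the finite type `κ`. -/
structure POVM (κ : Type*) [Fintype κ] (ι : Type*) [Fintype ι] [DecidableEq ι] where
  /-- the operator attached to each outcome -/
  op : κ → Matrix ι ι ℂ
  posSemidef : ∀ k, (op k).PosSemidef
  sum_eq_one : ∑ k, op k = 1

/-- The probability `tr(ρ E_k)` of outcome `k` when `M = {E_k}` is applied to the state `ρ`. -/
def POVM.prob {κ : Type*} [Fintype κ] (M : POVM κ ι) (ρ : Matrix ι ι ℂ) (k : κ) : ℝ :=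
  (ρ * M.op k).trace.re

/-- `n` copies of `ρ`: the tensor power `ρ^{⊗ n}`, as a matrix in the product basis of
`(ℂ^ι)^{⊗ n}`, which is indexed by `Fin n → ι`. -/
def copies (n : ℕ) (ρ : Matrix ι ι ℂ) : Matrix (Fin n → ι) (Fin n → ι) ℂ :=
  Matrix.of fun x y => ∏ i, ρ (x i) (y i)

/-- A tester using `n` copies of a `d`-dimensional state: a two-outcome measurement, possibly
entangled across all the copies, that reports `true` (for close) or `false` (for far). -/
abbrev Tester (n d : ℕ) : Type := POVM Bool (Fin n → Fin d)

end QuantumCert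

end

open scoped MatrixOrder ComplexOrder

noncomputable section

namespace QuantumCert

open Matrix

/-! ### Trace-norm duality and a fidelity lower bound -/

section

variable {ι : Type*} [Fintype ι]


/-! The test estimates a regularized Bures `χ²`-divergence between the unknown state and `σ`. In an
eigenbasis of `σ`, with eigenvalues `l i`, let `δ` be the difference of the two states, let `D i j =
2 δ i j / (l i + l j + 2η)`, and let `s = tr (δ D)`. The shift `η = ε / (6d)` keeps the weights
bounded even when `σ` is singular.

Two facts make `s` a good statistic. It vanishes when `ρ = σ`, and `1 - F ≤ 3 (η d + s / 4)`
(`DiagonalComparison.one_sub_fidelity_le`), so infidelity above `ε` forces `s ≥ 2ε/3`. The fidelity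
bound comes from trace-norm duality: the operator `G = D / 2` in the original basis solves a
Lyapunov equation carrying `σ + η` to `ρ + η` to first order, and this yields an explicit
contraction to test against `√ρ √σ`.

It can also be estimated cheaply. Since `s` is quadratic in `δ`, pairing each site of one block of
`m` copies with each site of a second block gives an unbiased observable (`distanceOp`, divided by
`m ^ 2`). Its variance (`DiagonalComparison.variance_le`) is at most `(2 d² + 2 (d/η) s) / m² +
(2/m) tr (r D²)`, where `r` is `ρ` in the eigenbasis, and in the far case `tr (r D²)` is controlled
by `s` and `s² d / ε`. With `m ≥ 200 d / ε`, Chebyshev's inequality for the spectral measure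
separates the two cases (`exists_tester`). -/

theorem re_trace_conjTranspose_mul_comm (A B : Matrix ι ι ℂ) :
    (Aᴴ * B).trace.re = (Bᴴ * A).trace.re := by
  have h : (Aᴴ * B)ᴴ = Bᴴ * A := by simp
  rw [← h, trace_conjTranspose]
  simp

theorem re_trace_conjTranspose_mul_self_nonneg (A : Matrix ι ι ℂ) : 0 ≤ (Aᴴ * A).trace.re :=
  (Complex.le_def.mp (posSemidef_conjTranspose_mul_self A).trace_nonneg).1

variable [DecidableEq ι]

theorem re_trace_mul_nonneg {A B : Matrix ι ι ℂ} (hA : A.PosSemidef) (hB : B.PosSemidef) :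
    0 ≤ (A * B).trace.re := by
  have hs : CFC.sqrt A * CFC.sqrt A = A := CFC.sqrt_mul_sqrt_self A hA.nonneg
  have hh : (CFC.sqrt A)ᴴ = CFC.sqrt A := (nonneg_iff_posSemidef.mp (CFC.sqrt_nonneg A)).1
  have h := hB.conjTranspose_mul_mul_same (CFC.sqrt A)
  have e : (A * B).trace = ((CFC.sqrt A)ᴴ * B * CFC.sqrt A).trace := by
    rw [hh, trace_mul_comm (CFC.sqrt A * B), ← mul_assoc, hs]
  rw [e]
  exact (Complex.le_def.mp h.trace_nonneg).1

theorem re_trace_mul_le_re_trace_mul {R A B : Matrix ι ι ℂ} (hR : R.PosSemidef) (h : A ≤ B) :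
    (R * A).trace.re ≤ (R * B).trace.re := by
  have := re_trace_mul_nonneg hR (le_iff.mp h)
  rw [mul_sub, trace_sub, Complex.sub_re] at this
  linarith

theorem traceNorm_nonneg (A : Matrix ι ι ℂ) : 0 ≤ traceNorm A :=
  (Complex.le_def.mp (nonneg_iff_posSemidef.mp (CFC.sqrt_nonneg (Aᴴ * A))).trace_nonneg).1

/-- By the C⋆-identity both products have operator norm `‖K‖²`. -/
theorem conjTranspose_mul_self_le_one {K : Matrix ι ι ℂ} (hK : K * Kᴴ ≤ 1) : Kᴴ * K ≤ 1 := by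
  open scoped Matrix.Norms.L2Operator in
  have h1 : ‖K * Kᴴ‖ ≤ 1 :=
    (CStarAlgebra.norm_le_one_iff_of_nonneg _ (posSemidef_self_mul_conjTranspose K).nonneg).mpr hK
  have h2 : ‖Kᴴ * K‖ ≤ 1 := by
    rw [← star_eq_conjTranspose] at h1 ⊢
    rw [CStarRing.norm_star_mul_self]
    rwa [CStarRing.norm_self_mul_star] at h1
  exact (CStarAlgebra.norm_le_one_iff_of_nonneg _
    (posSemidef_conjTranspose_mul_self K).nonneg).mp h2

/-- Duality between the trace norm and contractions. -/
theorem re_trace_mul_le_traceNorm {K : Matrix ι ι ℂ} (hK : K * Kᴴ ≤ 1) (M : Matrix ι ι ℂ) :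
    (K * M).trace.re ≤ traceNorm M := by
  have hPpos := nonneg_iff_posSemidef.mp (CFC.sqrt_nonneg (Mᴴ * M))
  have hPP : CFC.sqrt (Mᴴ * M) * CFC.sqrt (Mᴴ * M) = Mᴴ * M :=
    CFC.sqrt_mul_sqrt_self _ (posSemidef_conjTranspose_mul_self M).nonneg
  rw [traceNorm]
  generalize CFC.sqrt (Mᴴ * M) = P at hPpos hPP
  have hP := hPpos.1
  set U : Matrix ι ι ℂ := hP.eigenvectorUnitary.1 with hU
  have hUU : U * Uᴴ = 1 := by
    rw [← star_eq_conjTranspose]; exact (Matrix.mem_unitaryGroup_iff).mp hP.eigenvectorUnitary.2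
  have hUU' : Uᴴ * U = 1 := by
    rw [← star_eq_conjTranspose]; exact (Matrix.mem_unitaryGroup_iff').mp hP.eigenvectorUnitary.2
  have hspec : Uᴴ * P * U = diagonal (fun i => (hP.eigenvalues i : ℂ)) := by
    have := hP.spectral_theorem
    rw [Unitary.conjStarAlgAut_apply] at this
    conv_lhs => rw [this]
    rw [← hU, star_eq_conjTranspose]
    calc Uᴴ * (U * diagonal (RCLike.ofReal ∘ hP.eigenvalues) * Uᴴ) * U
        = (Uᴴ * U) * diagonal (RCLike.ofReal ∘ hP.eigenvalues) * (Uᴴ * U) := by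
          simp only [mul_assoc]
      _ = _ := by rw [hUU', one_mul, mul_one]; rfl
  -- In an eigenbasis of `P = √(Mᴴ M)` the columns of `Y` have norms equal to the eigenvalues of
  -- `P`, and those of `X` have norm at most one. The claim becomes Cauchy–Schwarz column by column.
  set X := Kᴴ * U with hX
  set Y := M * U with hY
  have hXX : 0 ≤ 1 - Xᴴ * X := by
    have := (le_iff.mp hK).conjTranspose_mul_mul_same U
    rw [mul_sub, sub_mul, mul_one, hUU'] at this
    simpa [hX, mul_assoc] using this.nonneg
  have hYY : Yᴴ * Y = diagonal (fun i => ((hP.eigenvalues i : ℂ)) ^ 2) := by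
    calc Yᴴ * Y = Uᴴ * (Mᴴ * M) * U := by simp [hY, mul_assoc]
      _ = (Uᴴ * P) * (U * Uᴴ) * (P * U) := by rw [← hPP, hUU]; simp [mul_assoc]
      _ = (Uᴴ * P * U) * (Uᴴ * P * U) := by simp only [mul_assoc]
      _ = _ := by rw [hspec, diagonal_mul_diagonal]; simp [sq]
  have htr : (K * M).trace = (Xᴴ * Y).trace := by
    calc (K * M).trace = (K * M * (U * Uᴴ)).trace := by rw [hUU, mul_one]
      _ = (Uᴴ * (K * M * U)).trace := by rw [← mul_assoc, trace_mul_comm]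
      _ = _ := by simp [hX, hY, mul_assoc]
  rw [htr, hP.trace_eq_sum_eigenvalues, trace]
  simp only [Complex.re_sum, diag_apply]
  refine Finset.sum_le_sum fun i _ => ?_
  have hp : 0 ≤ hP.eigenvalues i := hPpos.eigenvalues_nonneg i
  have hx : ((Xᴴ * X) i i).re ≤ 1 := by
    have := (Complex.le_def.mp ((nonneg_iff_posSemidef.mp hXX).diag_nonneg (i := i))).1
    simp at this; linarith
  have key : ∀ t : ℝ, 2 * t * ((Xᴴ * Y) i i).re ≤ t ^ 2 + hP.eigenvalues i ^ 2 := by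
    intro t
    have h := (Complex.le_def.mp ((posSemidef_conjTranspose_mul_self
      ((t : ℂ) • X - Y)).diag_nonneg (i := i))).1
    have hc : ((Yᴴ * X) i i).re = ((Xᴴ * Y) i i).re := by
      have e : (Yᴴ * X) = (Xᴴ * Y)ᴴ := by simp
      rw [e, conjTranspose_apply]; simp
    have hy : ((Yᴴ * Y) i i).re = hP.eigenvalues i ^ 2 := by
      rw [hYY, diagonal_apply_eq, ← Complex.ofReal_pow, Complex.ofReal_re]
    simp only [conjTranspose_sub, conjTranspose_smul, sub_mul, mul_sub, Matrix.sub_apply, smul_mul_assoc,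
      mul_smul_comm, Matrix.smul_apply, Complex.sub_re, smul_eq_mul, Complex.star_def,
      Complex.conj_ofReal, Complex.re_ofReal_mul, Complex.zero_re, hc, hy] at h
    nlinarith [mul_nonneg (sq_nonneg t) (sub_nonneg.mpr hx)]
  -- Taking `t` to be the inner product itself gives `t² ≤ p²` for the eigenvalue `p`.
  have h1 := key ((Xᴴ * Y) i i).re
  change _ ≤ ((hP.eigenvalues i : ℂ)).re
  rw [Complex.ofReal_re]
  by_contra! hlt
  nlinarith

theorem re_trace_mul_le_fidelity {K : Matrix ι ι ℂ} (hK : K * Kᴴ ≤ 1) (ρ σ : Matrix ι ι ℂ) :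
    (K * (CFC.sqrt ρ * CFC.sqrt σ)).trace.re ≤ fidelity ρ σ :=
  re_trace_mul_le_traceNorm hK _

theorem sqrt_le_sqrt_of_le {A B : Matrix ι ι ℂ} (h : A ≤ B) :
    CFC.sqrt A ≤ CFC.sqrt B := by
  open scoped Matrix.Norms.L2Operator in
  exact CFC.sqrt_le_sqrt A B h

/-- A lower bound on the fidelity of two states in terms of an operator transporting the second,
regularized by a multiple of the identity, to the first. -/
theorem one_sub_fidelity_le {ρ σ G : Matrix ι ι ℂ} (hρ : IsState ρ) (hσ : IsState σ) {η : ℝ}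
    (hη : 0 < η) (hG : G.IsHermitian)
    (hGσ : G * (σ + (η : ℂ) • 1) + (σ + (η : ℂ) • 1) * G = ρ - σ) :
    1 - fidelity ρ σ ≤
      3 * (η * Fintype.card ι + (G * (σ + (η : ℂ) • 1) * G).trace.re) := by
  have hη1 : ((η : ℂ) • (1 : Matrix ι ι ℂ)).PosDef :=
    PosDef.one.smul (by exact_mod_cast hη)
  set τ := σ + (η : ℂ) • (1 : Matrix ι ι ℂ) with hτ
  have hτpos : τ.PosSemidef := hσ.posSemidef.add hη1.posSemidef
  have hστ : σ ≤ τ := by rw [le_iff, hτ, add_sub_cancel_left]; exact hη1.posSemidef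
  set C := CFC.sqrt σ with hC
  set S := CFC.sqrt τ with hS
  set R := CFC.sqrt ρ with hR
  have hCC : C * C = σ := CFC.sqrt_mul_sqrt_self σ hσ.posSemidef.nonneg
  have hSS : S * S = τ := CFC.sqrt_mul_sqrt_self τ hτpos.nonneg
  have hRR : R * R = ρ := CFC.sqrt_mul_sqrt_self ρ hρ.posSemidef.nonneg
  have hCpos : C.PosSemidef := nonneg_iff_posSemidef.mp (CFC.sqrt_nonneg σ)
  have hCh : Cᴴ = C := hCpos.1
  have hSh : Sᴴ = S := (nonneg_iff_posSemidef.mp (CFC.sqrt_nonneg τ)).1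
  have hRh : Rᴴ = R := (nonneg_iff_posSemidef.mp (CFC.sqrt_nonneg ρ)).1
  have hGh : Gᴴ = G := hG
  set N := G * τ * G with hN
  have hNpos : N.PosSemidef := by
    have := hτpos.conjTranspose_mul_mul_same G
    rwa [hGh] at this
  -- The equation for `G` makes `B * Bᴴ = ρ + η + N`. This dominates `ρ`, so `B⁻¹ √ρ` is a
  -- contraction, and it is positive definite because `η > 0`, so the inverse exists.
  set B := (1 + G) * S with hB
  have hBB : B * Bᴴ = ρ + (η : ℂ) • 1 + N := by
    have e : B * Bᴴ = (1 + G) * (S * S) * (1 + G) := by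
      rw [hB, conjTranspose_mul, hSh, conjTranspose_add, hGh, conjTranspose_one]
      simp only [mul_assoc]
    rw [e, hSS]
    calc (1 + G) * τ * (1 + G) = τ + (G * τ + τ * G) + N := by rw [hN]; noncomm_ring
      _ = _ := by rw [hGσ, hτ]; abel
  have hBBpos : (B * Bᴴ).PosDef := by
    rw [hBB]
    exact (PosDef.posSemidef_add hρ.posSemidef hη1).add_posSemidef hNpos
  have hBu : IsUnit B.det := by
    have := hBBpos.isUnit
    rw [isUnit_iff_isUnit_det, det_mul] at this
    exact isUnit_of_mul_isUnit_left this
  set K := B⁻¹ * R with hK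
  have hKK : K * Kᴴ ≤ 1 := by
    have h1 : K * Kᴴ = B⁻¹ * ρ * (B⁻¹)ᴴ := by
      rw [hK, conjTranspose_mul, hRh, ← hRR]; simp only [mul_assoc]
    have h2 : (1 : Matrix ι ι ℂ) = B⁻¹ * (B * Bᴴ) * (B⁻¹)ᴴ := by
      rw [← mul_assoc, nonsing_inv_mul _ hBu, one_mul, ← conjTranspose_mul,
        nonsing_inv_mul _ hBu, conjTranspose_one]
    rw [le_iff, h1]
    conv => enter [1, 1]; rw [h2]
    rw [← sub_mul, ← mul_sub, hBB]
    have : (ρ + (η : ℂ) • 1 + N - ρ) = (η : ℂ) • 1 + N := by abel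
    rw [this]
    exact (hη1.posSemidef.add hNpos).mul_mul_conjTranspose_same _
  set A := R * Kᴴ with hA
  have hAh : Aᴴ = K * R := by rw [hA, conjTranspose_mul, conjTranspose_conjTranspose, hRh]
  have tAB : (Aᴴ * B).trace.re = 1 := by
    have : Aᴴ * B = B⁻¹ * ρ * B := by rw [hAh, hK, ← hRR]; simp only [mul_assoc]
    rw [this, trace_mul_comm, ← mul_assoc, mul_nonsing_inv _ hBu, one_mul, hρ.trace_eq_one,
      Complex.one_re]
  have tAA : (Aᴴ * A).trace.re ≤ 1 := by
    have : (Aᴴ * A).trace = (ρ * (Kᴴ * K)).trace := by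
      rw [hAh, hA, trace_mul_comm, ← hRR]
      calc (R * Kᴴ * (K * R)).trace = ((R * (Kᴴ * K)) * R).trace := by simp only [mul_assoc]
        _ = _ := by rw [trace_mul_comm]; simp only [mul_assoc]
    rw [this]
    refine (re_trace_mul_le_re_trace_mul hρ.posSemidef (conjTranspose_mul_self_le_one hKK)).trans ?_
    rw [mul_one, hρ.trace_eq_one, Complex.one_re]
  have hηtr : ((η : ℂ) • (1 : Matrix ι ι ℂ)).trace.re = η * Fintype.card ι := by
    rw [trace_smul, trace_one]; simp
  have tBB : (Bᴴ * B).trace.re = 1 + η * Fintype.card ι + N.trace.re := by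
    rw [trace_mul_comm, hBB, trace_add, trace_add, hρ.trace_eq_one, Complex.add_re, Complex.add_re,
      hηtr, Complex.one_re]
  have tCC : (Cᴴ * C).trace.re = 1 := by
    rw [hCh, hCC, hσ.trace_eq_one, Complex.one_re]
  have tSS : (Sᴴ * S).trace.re = 1 + η * Fintype.card ι := by
    rw [hSh, hSS, hτ, trace_add, Complex.add_re, hηtr, hσ.trace_eq_one, Complex.one_re]
  have tCS : 1 ≤ (Cᴴ * S).trace.re := by
    have := re_trace_mul_le_re_trace_mul hCpos (sqrt_le_sqrt_of_le hστ)
    rw [← hC, ← hS] at this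
    rw [hCh]
    rwa [hCC, hσ.trace_eq_one, Complex.one_re] at this
  have tGS : ((G * S)ᴴ * (G * S)).trace.re = N.trace.re := by
    rw [trace_mul_comm, conjTranspose_mul, hSh, hGh, hN, ← hSS]; simp only [mul_assoc]
  have hAC : (Aᴴ * C).trace.re ≤ fidelity ρ σ := by
    rw [hAh, mul_assoc]; exact re_trace_mul_le_fidelity hKK ρ σ
  have hBe : B = S + G * S := by rw [hB, add_mul, one_mul]
  -- Write `⟨·,·⟩` for the real Hilbert–Schmidt product and `e = η d + tr N`. Comparing `eB` with
  -- `tBB` gives `⟨S, G S⟩ = 0`, so `q2` and `tCS` yield `⟨B, C⟩ ≥ 1 - e / 2`. Then `q1` gives `4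
  -- ⟨B, C⟩ ≤ 2 + 2 F + 4 e`, whence the constant 3.
  have q1 := re_trace_conjTranspose_mul_self_nonneg (A - (2 : ℂ) • B + C)
  have q2 := re_trace_conjTranspose_mul_self_nonneg (S - C - G * S)
  have c1 := re_trace_conjTranspose_mul_comm A B
  have c2 := re_trace_conjTranspose_mul_comm A C
  have c3 := re_trace_conjTranspose_mul_comm B C
  have c4 := re_trace_conjTranspose_mul_comm S C
  have c5 := re_trace_conjTranspose_mul_comm S (G * S)
  have c6 := re_trace_conjTranspose_mul_comm C (G * S)
  have e3 : (Bᴴ * C).trace.re = (Sᴴ * C).trace.re + ((G * S)ᴴ * C).trace.re := by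
    rw [hBe, conjTranspose_add, add_mul, trace_add, Complex.add_re]
  have eB : (Bᴴ * B).trace.re = (Sᴴ * S).trace.re + (Sᴴ * (G * S)).trace.re
      + ((G * S)ᴴ * S).trace.re + ((G * S)ᴴ * (G * S)).trace.re := by
    rw [hBe, conjTranspose_add, add_mul, mul_add, mul_add]
    simp only [trace_add, Complex.add_re]; ring
  have x1 : ((A - (2 : ℂ) • B + C)ᴴ * (A - (2 : ℂ) • B + C)).trace.re =
      (Aᴴ * A).trace.re - 2 * (Aᴴ * B).trace.re + (Aᴴ * C).trace.re
      - 2 * (Bᴴ * A).trace.re + 4 * (Bᴴ * B).trace.re - 2 * (Bᴴ * C).trace.re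
      + (Cᴴ * A).trace.re - 2 * (Cᴴ * B).trace.re + (Cᴴ * C).trace.re := by
    simp only [conjTranspose_add, conjTranspose_sub, conjTranspose_smul, add_mul, sub_mul, mul_add,
      mul_sub, smul_mul_assoc, mul_smul_comm, trace_add, trace_sub, trace_smul, Complex.add_re,
      Complex.sub_re, smul_eq_mul, Complex.star_def, map_ofNat, Complex.mul_re]
    norm_num
    ring
  have x2 : ((S - C - G * S)ᴴ * (S - C - G * S)).trace.re =
      (Sᴴ * S).trace.re - (Sᴴ * C).trace.re - (Sᴴ * (G * S)).trace.re
      - (Cᴴ * S).trace.re + (Cᴴ * C).trace.re + (Cᴴ * (G * S)).trace.re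
      - ((G * S)ᴴ * S).trace.re + ((G * S)ᴴ * C).trace.re + ((G * S)ᴴ * (G * S)).trace.re := by
    simp only [conjTranspose_sub, sub_mul, mul_sub, trace_sub, Complex.sub_re]
    ring
  linarith

end

/-! ### Product operators on tensor powers -/

section Tensor

variable {ι : Type*} {n : ℕ}

/-- The tensor product of one matrix per site. -/
def prodOp (f : Fin n → Matrix ι ι ℂ) : Matrix (Fin n → ι) (Fin n → ι) ℂ :=
  of fun x y => ∏ i, f i (x i) (y i)

theorem copies_eq_prodOp [Fintype ι] (ρ : Matrix ι ι ℂ) :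
    copies n ρ = prodOp fun _ => ρ := rfl

theorem conjTranspose_prodOp (f : Fin n → Matrix ι ι ℂ) :
    (prodOp f)ᴴ = prodOp fun i => (f i)ᴴ := by
  ext x y
  simp [prodOp, conjTranspose_apply]

variable [Fintype ι]

theorem prodOp_mul (f g : Fin n → Matrix ι ι ℂ) : prodOp f * prodOp g = prodOp (f * g) := by
  classical
  ext x y
  simp only [prodOp, mul_apply, of_apply, Pi.mul_apply, ← Finset.prod_mul_distrib]
  rw [Finset.prod_univ_sum, Fintype.piFinset_univ]

theorem trace_prodOp (f : Fin n → Matrix ι ι ℂ) : (prodOp f).trace = ∏ i, (f i).trace := by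
  classical
  simp only [prodOp, trace, diag_apply, of_apply]
  rw [Finset.prod_univ_sum, Fintype.piFinset_univ]

theorem trace_copies (ρ : Matrix ι ι ℂ) : (copies n ρ).trace = ρ.trace ^ n := by
  rw [copies_eq_prodOp, trace_prodOp]; simp

theorem append_mul_append {m n : ℕ} {M : Type*} [Mul M] (f f' : Fin m → M) (g g' : Fin n → M) :
    Fin.append f g * Fin.append f' g' = Fin.append (f * f') (g * g') := by
  ext i
  refine Fin.addCases (fun i => ?_) (fun i => ?_) i <;> simp

theorem trace_copies_mul_prodOp_append {m : ℕ} (ρ : Matrix ι ι ℂ)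
    (f g : Fin m → Matrix ι ι ℂ) :
    (copies (m + m) ρ * prodOp (Fin.append f g)).trace =
      (∏ i, (ρ * f i).trace) * ∏ i, (ρ * g i).trace := by
  rw [copies_eq_prodOp, prodOp_mul, trace_prodOp, Fin.prod_univ_add]
  simp only [Pi.mul_apply, Fin.append_left, Fin.append_right]

variable [DecidableEq ι]

theorem posSemidef_copies {ρ : Matrix ι ι ℂ} (hρ : ρ.PosSemidef) : (copies n ρ).PosSemidef := by
  have hR : CFC.sqrt ρ * CFC.sqrt ρ = ρ := CFC.sqrt_mul_sqrt_self ρ hρ.nonneg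
  have hh : (CFC.sqrt ρ)ᴴ = CFC.sqrt ρ := (nonneg_iff_posSemidef.mp (CFC.sqrt_nonneg ρ)).1
  have : copies n ρ = (copies n (CFC.sqrt ρ))ᴴ * copies n (CFC.sqrt ρ) := by
    rw [copies_eq_prodOp, copies_eq_prodOp, conjTranspose_prodOp, prodOp_mul]
    congr 1
    ext1 i
    rw [Pi.mul_apply, hh, hR]
  rw [this]
  exact posSemidef_conjTranspose_mul_self _

theorem isState_copies {ρ : Matrix ι ι ℂ} (hρ : IsState ρ) : IsState (copies n ρ) :=
  ⟨posSemidef_copies hρ.posSemidef, by rw [trace_copies, hρ.trace_eq_one, one_pow]⟩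

end Tensor

/-! ### First and second moments of two-block pair observables -/

section Moments

variable {ι κ : Type*} [DecidableEq ι] [Fintype κ]

/-- The observable on `m + m` sites that sums `∑ k, w k • F k ⊗ G k` over all choices of one
site in the first half and one site in the second half. -/
def pairOp (m : ℕ) (w : κ → ℂ) (F G : κ → Matrix ι ι ℂ) :
    Matrix (Fin (m + m) → ι) (Fin (m + m) → ι) ℂ :=
  ∑ k, ∑ a : Fin m, ∑ b : Fin m,
    w k • prodOp (Fin.append (Pi.mulSingle a (F k)) (Pi.mulSingle b (G k)))

theorem conjTranspose_mulSingle {m : ℕ} (a : Fin m) (F : Matrix ι ι ℂ) (i : Fin m) :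
    ((Pi.mulSingle a F : Fin m → Matrix ι ι ℂ) i)ᴴ =
      (Pi.mulSingle a Fᴴ : Fin m → Matrix ι ι ℂ) i := by
  by_cases h : i = a
  · subst h; simp
  · simp [Pi.mulSingle_eq_of_ne h]

theorem conjTranspose_pairOp (m : ℕ) (w : κ → ℂ) (F G : κ → Matrix ι ι ℂ) :
    (pairOp m w F G)ᴴ =
      pairOp m (fun k => star (w k)) (fun k => (F k)ᴴ) (fun k => (G k)ᴴ) := by
  simp only [pairOp, conjTranspose_sum, conjTranspose_smul, conjTranspose_prodOp]
  refine Finset.sum_congr rfl fun k _ => Finset.sum_congr rfl fun a _ =>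
    Finset.sum_congr rfl fun b _ => ?_
  congr 2
  ext1 i
  refine Fin.addCases (fun i => ?_) (fun i => ?_) i <;>
    simp only [Fin.append_left, Fin.append_right, conjTranspose_mulSingle]

theorem pairOp_comp_equiv (m : ℕ) (e : κ ≃ κ) (w : κ → ℂ) (F G : κ → Matrix ι ι ℂ) :
    pairOp m (w ∘ e) (F ∘ e) (G ∘ e) = pairOp m w F G :=
  e.sum_comp fun k => ∑ a : Fin m, ∑ b : Fin m,
    w k • prodOp (Fin.append (Pi.mulSingle a (F k)) (Pi.mulSingle b (G k)))

variable [Fintype ι]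

/-- The covariance of two one-site observables. -/
def cov (ρ F G : Matrix ι ι ℂ) : ℂ := (ρ * (F * G)).trace - (ρ * F).trace * (ρ * G).trace

theorem sum_prod_trace_mulSingle {m : ℕ} {ρ : Matrix ι ι ℂ} (hρ : ρ.trace = 1)
    (F : Matrix ι ι ℂ) :
    ∑ a : Fin m, ∏ i, (ρ * (Pi.mulSingle a F : Fin m → Matrix ι ι ℂ) i).trace
      = m * (ρ * F).trace := by
  have h : ∀ a : Fin m, ∏ i, (ρ * (Pi.mulSingle a F : Fin m → Matrix ι ι ℂ) i).trace
      = (ρ * F).trace := by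
    intro a
    rw [Finset.prod_eq_single a]
    · simp
    · intro b _ hb
      rw [Pi.mulSingle_eq_of_ne hb, mul_one, hρ]
    · simp
  simp [h]

/-- Distinct sites are independent, so only the `m` coincidences `a = b` add a covariance to the
product of means. -/
theorem sum_sum_prod_trace_mulSingle {m : ℕ} {ρ : Matrix ι ι ℂ} (hρ : ρ.trace = 1)
    (F G : Matrix ι ι ℂ) :
    ∑ a : Fin m, ∑ b : Fin m, ∏ i, (ρ * ((Pi.mulSingle a F : Fin m → Matrix ι ι ℂ) i *
      (Pi.mulSingle b G : Fin m → Matrix ι ι ℂ) i)).trace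
      = m * cov ρ F G + m ^ 2 * ((ρ * F).trace * (ρ * G).trace) := by
  have h : ∀ a b : Fin m, ∏ i, (ρ * ((Pi.mulSingle a F : Fin m → Matrix ι ι ℂ) i *
      (Pi.mulSingle b G : Fin m → Matrix ι ι ℂ) i)).trace
      = (if a = b then cov ρ F G else 0) + (ρ * F).trace * (ρ * G).trace := by
    intro a b
    by_cases hab : a = b
    · subst hab
      rw [Finset.prod_eq_single a]
      · simp [cov]
      · intro b _ hb
        rw [Pi.mulSingle_eq_of_ne hb, Pi.mulSingle_eq_of_ne hb, mul_one, mul_one, hρ]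
      · simp
    · rw [Finset.prod_eq_mul a b hab]
      · rw [Pi.mulSingle_eq_same, Pi.mulSingle_eq_same, Pi.mulSingle_eq_of_ne hab,
          Pi.mulSingle_eq_of_ne (Ne.symm hab), mul_one, one_mul, if_neg hab, zero_add]
      · intro c _ hc
        rw [Pi.mulSingle_eq_of_ne hc.1, Pi.mulSingle_eq_of_ne hc.2, mul_one, mul_one, hρ]
      · simp
      · simp
  simp only [h, Finset.sum_add_distrib, Finset.sum_ite_eq, Finset.mem_univ, if_true,
    Finset.sum_const, Finset.card_univ, Fintype.card_fin, nsmul_eq_mul]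
  ring

theorem trace_copies_mul_pairOp {m : ℕ} {ρ : Matrix ι ι ℂ} (hρ : ρ.trace = 1)
    (w : κ → ℂ) (F G : κ → Matrix ι ι ℂ) :
    (copies (m + m) ρ * pairOp m w F G).trace =
      m ^ 2 * ∑ k, w k * ((ρ * F k).trace * (ρ * G k).trace) := by
  simp only [pairOp, Finset.mul_sum, mul_smul_comm, trace_sum, trace_smul,
    trace_copies_mul_prodOp_append, smul_eq_mul]
  refine Finset.sum_congr rfl fun k _ => ?_
  simp only [← Finset.mul_sum, ← Finset.sum_mul, sum_prod_trace_mulSingle hρ]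
  ring

theorem trace_copies_mul_pairOp_sq {m : ℕ} {ρ : Matrix ι ι ℂ} (hρ : ρ.trace = 1)
    (w : κ → ℂ) (F G : κ → Matrix ι ι ℂ) :
    (copies (m + m) ρ * (pairOp m w F G * pairOp m w F G)).trace =
      ∑ k, ∑ l, w k * w l *
        ((m * cov ρ (F k) (F l) + m ^ 2 * ((ρ * F k).trace * (ρ * F l).trace)) *
          (m * cov ρ (G k) (G l) + m ^ 2 * ((ρ * G k).trace * (ρ * G l).trace))) := by
  have h : pairOp m w F G * pairOp m w F G = ∑ k, ∑ l, ∑ a : Fin m, ∑ a' : Fin m, ∑ b : Fin m,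
      ∑ b' : Fin m, (w k * w l) • prodOp (Fin.append
        (Pi.mulSingle a (F k) * Pi.mulSingle a' (F l))
        (Pi.mulSingle b (G k) * Pi.mulSingle b' (G l))) := by
    rw [pairOp, Finset.sum_mul_sum]
    refine Finset.sum_congr rfl fun k _ => Finset.sum_congr rfl fun l _ => ?_
    rw [Finset.sum_mul_sum]
    refine Finset.sum_congr rfl fun a _ => Finset.sum_congr rfl fun a' _ => ?_
    rw [Finset.sum_mul_sum]
    refine Finset.sum_congr rfl fun b _ => Finset.sum_congr rfl fun b' _ => ?_
    rw [smul_mul_smul_comm, prodOp_mul, append_mul_append]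
  rw [h]
  simp only [Finset.mul_sum, mul_smul_comm, trace_sum, trace_smul,
    trace_copies_mul_prodOp_append, smul_eq_mul]
  refine Finset.sum_congr rfl fun k _ => Finset.sum_congr rfl fun l _ => ?_
  simp only [← Finset.mul_sum, ← Finset.sum_mul, Pi.mul_apply, sum_sum_prod_trace_mulSingle hρ]

end Moments

/-! ### Kernel-weighted sums over pairs of indices -/

section WeightedSums

variable {ι : Type*} [Fintype ι]

/-- The entrywise product of a scalar kernel with a matrix. -/
def weighted (c : ι → ι → ℂ) (M : Matrix ι ι ℂ) : Matrix ι ι ℂ := of fun i j => c i j * M i j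

theorem sum_pair_eq_trace_mul_weighted (c : ι → ι → ℂ) (M N : Matrix ι ι ℂ) :
    ∑ p : ι × ι, c p.1 p.2 * (M p.2 p.1 * N p.1 p.2) = (M * weighted c N).trace := by
  simp only [Fintype.sum_prod_type, trace, diag_apply, mul_apply, weighted, of_apply]
  rw [Finset.sum_comm]
  exact Finset.sum_congr rfl fun _ _ => Finset.sum_congr rfl fun _ _ => by ring

theorem trace_mul_weighted_comm {c : ι → ι → ℂ} (hc : ∀ i j, c i j = c j i)
    (M N : Matrix ι ι ℂ) : (M * weighted c N).trace = (N * weighted c M).trace := by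
  simp only [trace, diag_apply, mul_apply, weighted, of_apply]
  rw [Finset.sum_comm]
  exact Finset.sum_congr rfl fun i _ => Finset.sum_congr rfl fun j _ => by rw [hc i j]; ring

variable [DecidableEq ι]

theorem sum_pair_ite_eq_trace (c : ι → ι → ℂ) (r M : Matrix ι ι ℂ) :
    ∑ p : ι × ι, ∑ q : ι × ι, c p.1 p.2 * c q.1 q.2 *
      ((if p.2 = q.1 then r q.2 p.1 else 0) * (M p.1 p.2 * M q.1 q.2)) =
      (r * (weighted c M * weighted c M)).trace := by
  simp only [Fintype.sum_prod_type, trace, diag_apply, mul_apply, weighted, of_apply, ite_mul,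
    zero_mul, mul_ite, mul_zero, Finset.mul_sum]
  have h : ∀ i j : ι, ∑ k, ∑ l, (if j = k then c i j * c k l * (r l i * (M i j * M k l)) else 0)
      = ∑ l, c i j * c j l * (r l i * (M i j * M j l)) := by
    intro i j
    rw [Finset.sum_comm]
    simp
  simp only [h]
  have h2 : ∀ i : ι, ∑ j, ∑ l, c i j * c j l * (r l i * (M i j * M j l)) =
      ∑ l, ∑ j, r l i * (c i j * M i j * (c j l * M j l)) := by
    intro i
    rw [Finset.sum_comm]
    exact Finset.sum_congr rfl fun _ _ => Finset.sum_congr rfl fun _ _ => by ring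
  simp only [h2]
  exact Finset.sum_comm

theorem sum_pair_ite_swap_eq_trace {c : ι → ι → ℂ} (hc : ∀ i j, c i j = c j i)
    (r M : Matrix ι ι ℂ) :
    ∑ p : ι × ι, ∑ q : ι × ι, c p.1 p.2 * c q.1 q.2 *
      ((if p.1 = q.2 then r q.1 p.2 else 0) * (M p.2 p.1 * M q.2 q.1)) =
      (r * (weighted c M * weighted c M)).trace := by
  rw [← sum_pair_ite_eq_trace, ← (Equiv.prodComm ι ι).sum_comp]
  refine Finset.sum_congr rfl fun p _ => ?_
  rw [← (Equiv.prodComm ι ι).sum_comp]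
  refine Finset.sum_congr rfl fun q _ => ?_
  simp only [Equiv.prodComm_apply, Prod.fst_swap, Prod.snd_swap, hc p.2 p.1, hc q.2 q.1]
  congr

/-- The two constraints together force `q = p.swap`, leaving only diagonal entries of `r`. -/
theorem sum_pair_ite_ite {c : ι → ι → ℂ} (hc : ∀ i j, c i j = c j i) (r : Matrix ι ι ℂ) :
    ∑ p : ι × ι, ∑ q : ι × ι, c p.1 p.2 * c q.1 q.2 *
      ((if p.2 = q.1 then r q.2 p.1 else 0) * (if p.1 = q.2 then r q.1 p.2 else 0)) =
      ∑ i, ∑ j, c i j ^ 2 * (r i i * r j j) := by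
  rw [Fintype.sum_prod_type]
  refine Finset.sum_congr rfl fun i _ => Finset.sum_congr rfl fun j _ => ?_
  rw [Finset.sum_eq_single (j, i)]
  · simp only [if_true]
    rw [hc j i]; ring
  · rintro ⟨k, l⟩ - hkl
    by_cases h1 : j = k
    · by_cases h2 : i = l
      · subst h1 h2; exact absurd rfl hkl
      · simp [h2]
    · simp [h1]
  · simp

/-- The two factors are the second moments of the two blocks, for matrix units centred so that their
means are entries of `δ`. Powers of `m` sort the terms: `m ^ 4` carries the squared mean, `m ^ 3`
one covariance, `m ^ 2` two. -/
theorem sum_pair_secondMoment {c : ι → ι → ℂ} (hc : ∀ i j, c i j = c j i)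
    (r δ : Matrix ι ι ℂ) (m : ℂ) :
    ∑ p : ι × ι, ∑ q : ι × ι, c p.1 p.2 * c q.1 q.2 *
      ((m * ((if p.2 = q.1 then r q.2 p.1 else 0) - r p.2 p.1 * r q.2 q.1)
          + m ^ 2 * (δ p.2 p.1 * δ q.2 q.1)) *
        (m * ((if p.1 = q.2 then r q.1 p.2 else 0) - r p.1 p.2 * r q.1 q.2)
          + m ^ 2 * (δ p.1 p.2 * δ q.1 q.2))) =
      m ^ 2 * (∑ i, ∑ j, c i j ^ 2 * (r i i * r j j)
        - 2 * (r * (weighted c r * weighted c r)).trace + (r * weighted c r).trace ^ 2)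
      + 2 * m ^ 3 * ((r * (weighted c δ * weighted c δ)).trace - (r * weighted c δ).trace ^ 2)
      + m ^ 4 * (δ * weighted c δ).trace ^ 2 := by
  have sq : ∀ M N : Matrix ι ι ℂ, ∑ p : ι × ι, ∑ q : ι × ι, c p.1 p.2 * c q.1 q.2 *
      ((M p.2 p.1 * M q.2 q.1) * (N p.1 p.2 * N q.1 q.2)) = (M * weighted c N).trace ^ 2 := by
    intro M N
    rw [← sum_pair_eq_trace_mul_weighted, pow_two, Finset.sum_mul_sum]
    exact Finset.sum_congr rfl fun _ _ => Finset.sum_congr rfl fun _ _ => by ring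
  have e1 := sum_pair_ite_ite hc r
  have e2 := sum_pair_ite_eq_trace c r r
  have e3 := sum_pair_ite_swap_eq_trace hc r r
  have e4 := sum_pair_ite_eq_trace c r δ
  have e5 := sum_pair_ite_swap_eq_trace hc r δ
  have e6 := sq r r
  have e7 := sq r δ
  have e8 := sq δ r
  have e9 := sq δ δ
  rw [trace_mul_weighted_comm hc δ r] at e8
  calc _ = m ^ 2 * (∑ p : ι × ι, ∑ q : ι × ι, c p.1 p.2 * c q.1 q.2 *
      ((if p.2 = q.1 then r q.2 p.1 else 0) * (if p.1 = q.2 then r q.1 p.2 else 0)))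
      - m ^ 2 * (∑ p : ι × ι, ∑ q : ι × ι, c p.1 p.2 * c q.1 q.2 *
      ((if p.2 = q.1 then r q.2 p.1 else 0) * (r p.1 p.2 * r q.1 q.2)))
      - m ^ 2 * (∑ p : ι × ι, ∑ q : ι × ι, c p.1 p.2 * c q.1 q.2 *
      ((if p.1 = q.2 then r q.1 p.2 else 0) * (r p.2 p.1 * r q.2 q.1)))
      + m ^ 2 * (∑ p : ι × ι, ∑ q : ι × ι, c p.1 p.2 * c q.1 q.2 *
      ((r p.2 p.1 * r q.2 q.1) * (r p.1 p.2 * r q.1 q.2)))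
      + m ^ 3 * (∑ p : ι × ι, ∑ q : ι × ι, c p.1 p.2 * c q.1 q.2 *
      ((if p.2 = q.1 then r q.2 p.1 else 0) * (δ p.1 p.2 * δ q.1 q.2)))
      + m ^ 3 * (∑ p : ι × ι, ∑ q : ι × ι, c p.1 p.2 * c q.1 q.2 *
      ((if p.1 = q.2 then r q.1 p.2 else 0) * (δ p.2 p.1 * δ q.2 q.1)))
      - m ^ 3 * (∑ p : ι × ι, ∑ q : ι × ι, c p.1 p.2 * c q.1 q.2 *
      ((r p.2 p.1 * r q.2 q.1) * (δ p.1 p.2 * δ q.1 q.2)))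
      - m ^ 3 * (∑ p : ι × ι, ∑ q : ι × ι, c p.1 p.2 * c q.1 q.2 *
      ((δ p.2 p.1 * δ q.2 q.1) * (r p.1 p.2 * r q.1 q.2)))
      + m ^ 4 * (∑ p : ι × ι, ∑ q : ι × ι, c p.1 p.2 * c q.1 q.2 *
      ((δ p.2 p.1 * δ q.2 q.1) * (δ p.1 p.2 * δ q.1 q.2))) := by
        simp only [Finset.mul_sum, ← Finset.sum_add_distrib, ← Finset.sum_sub_distrib]
        exact Finset.sum_congr rfl fun _ _ => Finset.sum_congr rfl fun _ _ => by ring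
    _ = _ := by
        rw [e1, e2, e3, e4, e5, e6, e7, e8, e9]; ring

end WeightedSums

/-! ### The distance observable and its moments -/

section Observable

variable {ι : Type*} [Fintype ι] [DecidableEq ι]

theorem cov_sub_smul_one {ρ : Matrix ι ι ℂ} (hρ : ρ.trace = 1) (F G : Matrix ι ι ℂ) (x y : ℂ) :
    cov ρ (F - x • 1) (G - y • 1) = cov ρ F G := by
  simp only [cov, mul_sub, sub_mul, trace_sub, smul_mul_assoc, mul_smul_comm, one_mul, mul_one,
    trace_smul, hρ, smul_eq_mul]
  ring

/-- The matrix unit `|i⟩⟨j|` in the basis of the columns of `U`, shifted by a scalar. -/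
def shiftedUnit (U : Matrix ι ι ℂ) (l : ι → ℝ) (p : ι × ι) : Matrix ι ι ℂ :=
  U * single p.1 p.2 1 * Uᴴ - (diagonal (fun i => (l i : ℂ)) p.2 p.1) • 1

theorem conjTranspose_shiftedUnit (U : Matrix ι ι ℂ) (l : ι → ℝ) (p : ι × ι) :
    (shiftedUnit U l p)ᴴ = shiftedUnit U l p.swap := by
  have h : star (diagonal (fun i => (l i : ℂ)) p.2 p.1) =
      diagonal (fun i => (l i : ℂ)) p.1 p.2 := by
    by_cases h : p.1 = p.2
    · simp [h]
    · simp [diagonal_apply_ne _ h, diagonal_apply_ne _ (Ne.symm h)]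
  simp only [shiftedUnit, conjTranspose_sub, conjTranspose_mul, conjTranspose_smul, h,
    conjTranspose_single, conjTranspose_conjTranspose, conjTranspose_one, star_one, Prod.fst_swap,
    Prod.snd_swap, mul_assoc]

theorem trace_mul_basis (ρ U : Matrix ι ι ℂ) (i j : ι) :
    (ρ * (U * single i j 1 * Uᴴ)).trace = (Uᴴ * ρ * U) j i := by
  have : (ρ * (U * single i j 1 * Uᴴ)).trace = (single i j 1 * (Uᴴ * ρ * U)).trace := by
    calc _ = ((ρ * U * single i j 1) * Uᴴ).trace := by simp only [mul_assoc]
      _ = ((Uᴴ * ρ * U) * single i j 1).trace := by rw [trace_mul_comm]; simp only [mul_assoc]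
      _ = _ := trace_mul_comm _ _
  rw [this, trace_single_mul]
  simp

theorem trace_mul_shiftedUnit {ρ : Matrix ι ι ℂ} (hρ : ρ.trace = 1) (U : Matrix ι ι ℂ)
    (l : ι → ℝ) (p : ι × ι) :
    (ρ * shiftedUnit U l p).trace = (Uᴴ * ρ * U - diagonal fun i => (l i : ℂ)) p.2 p.1 := by
  rw [shiftedUnit, mul_sub, trace_sub, trace_mul_basis, mul_smul_comm, mul_one, trace_smul, hρ,
    smul_eq_mul, mul_one, Matrix.sub_apply]

theorem cov_shiftedUnit {ρ U : Matrix ι ι ℂ} (hρ : ρ.trace = 1) (hU : Uᴴ * U = 1)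
    (l : ι → ℝ) (p q : ι × ι) :
    cov ρ (shiftedUnit U l p) (shiftedUnit U l q) =
      (if p.2 = q.1 then (Uᴴ * ρ * U) q.2 p.1 else 0)
        - (Uᴴ * ρ * U) p.2 p.1 * (Uᴴ * ρ * U) q.2 q.1 := by
  rw [shiftedUnit, shiftedUnit, cov_sub_smul_one hρ, cov, trace_mul_basis, trace_mul_basis]
  congr 1
  have : U * single p.1 p.2 1 * Uᴴ * (U * single q.1 q.2 1 * Uᴴ) =
      U * (single p.1 p.2 1 * single q.1 q.2 1) * Uᴴ := by
    calc _ = U * single p.1 p.2 1 * (Uᴴ * U) * single q.1 q.2 1 * Uᴴ := by simp only [mul_assoc]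
      _ = _ := by rw [hU, mul_one]; simp only [mul_assoc]
  rw [this]
  split_ifs with h
  · rw [h, single_mul_single_same, mul_one, trace_mul_basis]
  · rw [single_mul_single_of_ne (h := h)]
    simp

/-- The observable that estimates a weighted squared distance between the unknown state and
`U * diagonal l * Uᴴ`. -/
def distanceOp (m : ℕ) (c : ι → ι → ℝ) (U : Matrix ι ι ℂ) (l : ι → ℝ) :
    Matrix (Fin (m + m) → ι) (Fin (m + m) → ι) ℂ :=
  pairOp m (fun p : ι × ι => (c p.1 p.2 : ℂ)) (shiftedUnit U l) (shiftedUnit U l ∘ Prod.swap)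

/-- The adjoint exchanges the units `(i, j)` and `(j, i)`, which the symmetric kernel allows to be
undone by reindexing. -/
theorem isHermitian_distanceOp (m : ℕ) {c : ι → ι → ℝ} (hc : ∀ i j, c i j = c j i)
    (U : Matrix ι ι ℂ) (l : ι → ℝ) : (distanceOp m c U l).IsHermitian := by
  rw [IsHermitian, distanceOp, conjTranspose_pairOp]
  rw [← pairOp_comp_equiv m (Equiv.prodComm ι ι) (fun p : ι × ι => (c p.1 p.2 : ℂ))]
  congr 1
  · ext p; simp [hc p.2 p.1]
  · ext1 p; simp [conjTranspose_shiftedUnit]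
  · ext1 p; simp [conjTranspose_shiftedUnit]

variable {m : ℕ} {c : ι → ι → ℝ} {U ρ : Matrix ι ι ℂ}

theorem trace_copies_mul_distanceOp (hρ : ρ.trace = 1) (c : ι → ι → ℝ) (U : Matrix ι ι ℂ)
    (l : ι → ℝ) {r δ : Matrix ι ι ℂ} (hr : r = Uᴴ * ρ * U)
    (hδ : δ = r - diagonal fun i => (l i : ℂ)) :
    (copies (m + m) ρ * distanceOp m c U l).trace =
      m ^ 2 * (δ * weighted (fun i j => (c i j : ℂ)) δ).trace := by
  rw [distanceOp, trace_copies_mul_pairOp hρ, ← sum_pair_eq_trace_mul_weighted]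
  simp only [Function.comp_apply, trace_mul_shiftedUnit hρ, ← hr, ← hδ, Prod.fst_swap,
    Prod.snd_swap]

theorem trace_copies_mul_distanceOp_sq (hρ : ρ.trace = 1) (hU : Uᴴ * U = 1)
    (hc : ∀ i j, c i j = c j i) (l : ι → ℝ) {r δ : Matrix ι ι ℂ} (hr : r = Uᴴ * ρ * U)
    (hδ : δ = r - diagonal fun i => (l i : ℂ)) {K D : Matrix ι ι ℂ}
    (hK : K = weighted (fun i j => (c i j : ℂ)) r)
    (hD : D = weighted (fun i j => (c i j : ℂ)) δ) :
    (copies (m + m) ρ * (distanceOp m c U l * distanceOp m c U l)).trace =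
      m ^ 2 * (∑ i, ∑ j, (c i j : ℂ) ^ 2 * (r i i * r j j)
        - 2 * (r * (K * K)).trace + (r * K).trace ^ 2)
      + 2 * m ^ 3 * ((r * (D * D)).trace - (r * D).trace ^ 2)
      + m ^ 4 * (δ * D).trace ^ 2 := by
  rw [hK, hD, ← sum_pair_secondMoment (fun i j => by rw [hc i j]) r δ, distanceOp,
    trace_copies_mul_pairOp_sq hρ]
  simp only [Function.comp_apply, trace_mul_shiftedUnit hρ, cov_shiftedUnit hρ hU, ← hr, ← hδ,
    Prod.fst_swap, Prod.snd_swap]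

end Observable

/-! ### Operator inequalities for Hermitian matrices -/

section

variable {ι : Type*} [Fintype ι]

theorem im_trace_mul_eq_zero {A B : Matrix ι ι ℂ} (hA : A.IsHermitian) (hB : B.IsHermitian) :
    (A * B).trace.im = 0 := by
  have h : star (A * B).trace = (A * B).trace := by
    rw [← trace_conjTranspose, conjTranspose_mul, hA.eq, hB.eq, trace_mul_comm]
  exact Complex.conj_eq_iff_im.mp h

variable [DecidableEq ι]

theorem re_trace_mul_sub_sq {R H : Matrix ι ι ℂ} (hR : R.trace = 1) (s : ℝ) :
    (R * ((H - (s : ℂ) • 1) * (H - (s : ℂ) • 1))).trace.re =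
      (R * (H * H)).trace.re - 2 * s * (R * H).trace.re + s ^ 2 := by
  simp only [mul_sub, sub_mul, smul_mul_assoc, mul_smul_comm, one_mul, mul_one, trace_sub,
    trace_smul, hR, smul_eq_mul, Complex.sub_re, Complex.re_ofReal_mul, Complex.ofReal_re]
  ring

/-- Nonnegativity of the variance of `H` in the state `R`. -/
theorem sq_re_trace_mul_le {R H : Matrix ι ι ℂ} (hR : IsState R) (hH : H.IsHermitian) :
    (R * H).trace.re ^ 2 ≤ (R * (H * H)).trace.re := by
  have h1 : ((H - (((R * H).trace.re : ℝ) : ℂ) • 1) *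
      (H - (((R * H).trace.re : ℝ) : ℂ) • 1)).PosSemidef := by
    have hh : (H - (((R * H).trace.re : ℝ) : ℂ) • 1)ᴴ = H - (((R * H).trace.re : ℝ) : ℂ) • 1 := by
      rw [conjTranspose_sub, conjTranspose_smul, conjTranspose_one, hH.eq, Complex.star_def,
        Complex.conj_ofReal]
    conv => arg 1; arg 1; rw [← hh]
    exact posSemidef_conjTranspose_mul_self _
  have := re_trace_mul_nonneg hR.posSemidef h1
  rw [re_trace_mul_sub_sq hR.trace_eq_one] at this
  nlinarith

theorem le_re_trace_smul_one {A : Matrix ι ι ℂ} (hA : A.PosSemidef) :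
    A ≤ (A.trace.re : ℂ) • 1 := by
  have h : A ≤ algebraMap ℝ (Matrix ι ι ℂ) A.trace.re := by
    refine (le_algebraMap_iff_spectrum_le (ha := hA.1.isSelfAdjoint)).mpr fun x hx => ?_
    rw [hA.1.spectrum_real_eq_range_eigenvalues] at hx
    obtain ⟨i, rfl⟩ := hx
    rw [hA.1.trace_eq_sum_eigenvalues, Complex.re_sum]
    exact Finset.single_le_sum (f := fun i => (((hA.1.eigenvalues i : ℝ) : ℂ)).re)
      (fun j _ => hA.eigenvalues_nonneg j) (Finset.mem_univ i)
  convert h using 1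
  ext i j
  simp [algebraMap_matrix_apply, one_apply]

/-- Follows from `2h (h - H) = (h² - H²) + (h - H)²`, where `H² ≤ tr (H²) ≤ h²`. -/
theorem le_smul_one_of_trace_mul_self_le {H : Matrix ι ι ℂ} (hH : H.IsHermitian) {h : ℝ}
    (h0 : 0 < h) (hle : (H * H).trace.re ≤ h ^ 2) : H ≤ (h : ℂ) • 1 := by
  have hHH : (H * H).PosSemidef := by
    have := posSemidef_conjTranspose_mul_self H
    rwa [hH.eq] at this
  have h1 : (((h ^ 2 : ℝ) : ℂ) • 1 - H * H).PosSemidef := by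
    have e : ((h ^ 2 : ℝ) : ℂ) • (1 : Matrix ι ι ℂ) - H * H =
        (((h ^ 2 - (H * H).trace.re : ℝ) : ℂ) • 1) + (((H * H).trace.re : ℂ) • 1 - H * H) := by
      push_cast; rw [sub_smul]; abel
    rw [e]
    exact (PosSemidef.one.smul (by exact_mod_cast sub_nonneg.mpr hle)).add
      (le_iff.mp (le_re_trace_smul_one hHH))
  have h2 : (((h : ℂ) • 1 - H) * ((h : ℂ) • 1 - H)).PosSemidef := by
    have hh : ((h : ℂ) • 1 - H)ᴴ = (h : ℂ) • 1 - H := by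
      rw [conjTranspose_sub, conjTranspose_smul, conjTranspose_one, hH.eq, Complex.star_def,
        Complex.conj_ofReal]
    conv => arg 1; arg 1; rw [← hh]
    exact posSemidef_conjTranspose_mul_self _
  have e : (h : ℂ) • 1 - H = ((2 * h)⁻¹ : ℂ) • ((((h ^ 2 : ℝ) : ℂ) • 1 - H * H) +
      (((h : ℂ) • 1 - H) * ((h : ℂ) • 1 - H))) := by
    have hne : (h : ℂ) ≠ 0 := by exact_mod_cast h0.ne'
    have : (((h ^ 2 : ℝ) : ℂ) • 1 - H * H) + (((h : ℂ) • 1 - H) * ((h : ℂ) • 1 - H)) =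
        (2 * h : ℂ) • ((h : ℂ) • 1 - H) := by
      simp only [mul_sub, sub_mul, smul_mul_assoc, mul_smul_comm, one_mul, mul_one, smul_sub,
        smul_smul]
      push_cast
      module
    rw [this, smul_smul, inv_mul_cancel₀ (by simpa using hne), one_smul]
  rw [le_iff, e]
  refine (h1.add h2).smul ?_
  have : (0 : ℝ) ≤ (2 * h)⁻¹ := by positivity
  exact_mod_cast this

/-! ### Threshold measurements and Chebyshev's inequality -/

section Chebyshev

/-- The two-outcome measurement that reports `true` on the spectral subspace of `H` below `t`. -/
def thresholdPOVM (H : Matrix ι ι ℂ) (hH : H.IsHermitian) (t : ℝ) : POVM Bool ι where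
  op k := cfc (fun x : ℝ => if (decide (x < t)) = k then 1 else 0) H
  posSemidef k := nonneg_iff_posSemidef.mp <| cfc_nonneg fun x _ => by split_ifs <;> norm_num
  sum_eq_one := by
    have hc : ∀ f : ℝ → ℝ, ContinuousOn f (spectrum ℝ H) := fun f =>
      (Matrix.finite_real_spectrum).continuousOn f
    rw [Fintype.sum_bool, ← cfc_add (hf := hc _) (hg := hc _)]
    have : (fun x : ℝ => (if (decide (x < t)) = true then (1 : ℝ) else 0) +
        (if (decide (x < t)) = false then (1 : ℝ) else 0)) = fun _ => 1 := by
      ext x; by_cases h : x < t <;> simp [h]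
    rw [this, cfc_const_one ℝ H (ha := hH.isSelfAdjoint)]

theorem prob_true_add_prob_false (T : POVM Bool ι) {R : Matrix ι ι ℂ} (hR : R.trace = 1) :
    T.prob R true + T.prob R false = 1 := by
  have := T.sum_eq_one
  rw [Fintype.sum_bool] at this
  rw [POVM.prob, POVM.prob, ← Complex.add_re, ← trace_add, ← mul_add, this, mul_one, hR,
    Complex.one_re]

/-- Chebyshev's inequality for the spectral measure of an observable. -/
theorem prob_thresholdPOVM_mul_le {R H : Matrix ι ι ℂ} (hR : R.PosSemidef) (hH : H.IsHermitian)
    {t s a : ℝ} (k : Bool)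
    (h : ∀ x : ℝ, decide (x < t) = k → a ≤ (x - s) ^ 2) :
    (thresholdPOVM H hH t).prob R k * a ≤
      (R * ((H - (s : ℂ) • 1) * (H - (s : ℂ) • 1))).trace.re := by
  have hc : ∀ f : ℝ → ℝ, ContinuousOn f (spectrum ℝ H) := fun f =>
    (Matrix.finite_real_spectrum).continuousOn f
  have hsq : cfc (fun x : ℝ => (x - s) * (x - s)) H =
      (H - (s : ℂ) • 1) * (H - (s : ℂ) • 1) := by
    rw [cfc_mul (fun x : ℝ => x - s) (fun x : ℝ => x - s) H,
      cfc_sub (fun x : ℝ => x) (fun _ => s) H,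
      cfc_id' ℝ H (ha := hH.isSelfAdjoint), cfc_const s H (ha := hH.isSelfAdjoint)]
    have : algebraMap ℝ (Matrix ι ι ℂ) s = (s : ℂ) • 1 := by
      ext i j
      simp [algebraMap_matrix_apply, one_apply]
    rw [this]
  have hle : a • cfc (fun x : ℝ => if (decide (x < t)) = k then (1 : ℝ) else 0) H ≤
      (H - (s : ℂ) • 1) * (H - (s : ℂ) • 1) := by
    rw [← hsq, ← cfc_const_mul a _ H (hf := hc _)]
    refine cfc_mono (fun x _ => ?_) (hf := hc _) (hg := hc _)
    split_ifs with hx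
    · rw [mul_one, ← pow_two]; exact h x hx
    · rw [mul_zero]; exact mul_self_nonneg _
  have := re_trace_mul_le_re_trace_mul hR hle
  refine le_trans (le_of_eq ?_) this
  rw [POVM.prob, mul_smul_comm, trace_smul, Complex.smul_re, smul_eq_mul, mul_comm]
  rfl

end Chebyshev

/-! ### The Bures kernel and its Lyapunov equation -/

section BuresKernel

variable {ι : Type*}

/-- The kernel of the Bures `χ²`-divergence. -/
def buresWeight (l : ι → ℝ) (i j : ι) : ℝ := 2 / (l i + l j)

theorem buresWeight_comm (l : ι → ℝ) (i j : ι) : buresWeight l i j = buresWeight l j i := by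
  rw [buresWeight, buresWeight, add_comm]

/-- AM–GM; it decouples the two indices, so that the double sum in the variance factors. -/
theorem buresWeight_sq_le {l : ι → ℝ} (hl : ∀ i, 0 < l i) (i j : ι) :
    buresWeight l i j ^ 2 ≤ (l i)⁻¹ * (l j)⁻¹ := by
  have hi := hl i
  have hj := hl j
  rw [buresWeight, div_pow, ← mul_inv, ← one_div, div_le_div_iff₀ (by positivity) (by positivity)]
  nlinarith [sq_nonneg (l i - l j)]

theorem isHermitian_weighted_bures {l : ι → ℝ} {δ D : Matrix ι ι ℂ}
    (hδ : δ.IsHermitian)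
    (hD : D = weighted (fun i j => (buresWeight l i j : ℂ)) δ) : D.IsHermitian := by
  ext i j
  rw [conjTranspose_apply, hD, weighted, of_apply, of_apply, star_mul', hδ.apply,
    Complex.star_def, Complex.conj_ofReal, buresWeight_comm]

end BuresKernel

section BuresWeights

variable {l : ι → ℝ} {δ D : Matrix ι ι ℂ}

theorem weighted_bures_anticomm (hl : ∀ i, 0 < l i)
    (hD : D = weighted (fun i j => (buresWeight l i j : ℂ)) δ) :
    D * diagonal (fun i => (l i : ℂ)) + diagonal (fun i => (l i : ℂ)) * D = (2 : ℂ) • δ := by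
  ext i j
  have h : (l i : ℂ) + l j ≠ 0 := by exact_mod_cast (add_pos (hl i) (hl j)).ne'
  simp only [Matrix.add_apply, mul_diagonal, diagonal_mul, Matrix.smul_apply, hD, weighted,
    of_apply, buresWeight, smul_eq_mul]
  push_cast
  field_simp
  ring

/-- Pairing the anticommutator equation with `D` makes its two terms equal by cyclicity of the
trace. -/
theorem trace_mul_weighted_bures (hl : ∀ i, 0 < l i)
    (hD : D = weighted (fun i j => (buresWeight l i j : ℂ)) δ) :
    (δ * D).trace = (D * diagonal (fun i => (l i : ℂ)) * D).trace := by
  have h := congrArg (fun M => (M * D).trace) (weighted_bures_anticomm hl hD)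
  simp only [add_mul, trace_add, smul_mul_assoc, trace_smul, smul_eq_mul] at h
  have e : (diagonal (fun i => (l i : ℂ)) * D * D).trace =
      (D * diagonal (fun i => (l i : ℂ)) * D).trace := by
    rw [trace_mul_comm, mul_assoc]
  rw [e] at h
  linear_combination -h / 2

theorem trace_mul_weighted_bures_sq (hl : ∀ i, 0 < l i)
    (hD : D = weighted (fun i j => (buresWeight l i j : ℂ)) δ) :
    (δ * (D * D)).trace = (D * diagonal (fun i => (l i : ℂ)) * D * D).trace := by
  have h := congrArg (fun M => (M * (D * D)).trace) (weighted_bures_anticomm hl hD)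
  simp only [add_mul, trace_add, smul_mul_assoc, trace_smul, smul_eq_mul] at h
  have e : (diagonal (fun i => (l i : ℂ)) * D * (D * D)).trace =
      (D * diagonal (fun i => (l i : ℂ)) * D * D).trace := by
    rw [← mul_assoc, trace_mul_comm]; simp only [mul_assoc]
  rw [e, ← mul_assoc] at h
  linear_combination -h / 2

theorem posSemidef_mul_diagonal_mul {l : ι → ℝ} (hl : ∀ i, 0 ≤ l i) (hDh : D.IsHermitian) :
    (D * diagonal (fun i => (l i : ℂ)) * D).PosSemidef := by
  have h : (diagonal (fun i => (l i : ℂ))).PosSemidef :=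
    posSemidef_diagonal_iff.mpr fun i => by exact_mod_cast hl i
  have := h.conjTranspose_mul_mul_same D
  rwa [hDh.eq] at this

/-- The right side is a sum of `l j * |D i j|²`; the terms with `i = j` alone give the left side. -/
theorem sum_div_sq_le (hl : ∀ i, 0 < l i) (hδ : δ.IsHermitian)
    (hD : D = weighted (fun i j => (buresWeight l i j : ℂ)) δ) :
    ∑ i, (δ i i).re ^ 2 / l i ≤ (δ * D).trace.re := by
  have hDh := isHermitian_weighted_bures hδ hD
  rw [trace_mul_weighted_bures hl hD, trace, Complex.re_sum]
  refine Finset.sum_le_sum fun i _ => ?_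
  rw [diag_apply, mul_apply, Complex.re_sum]
  have hterm : ∀ j, ((D * diagonal (fun i => (l i : ℂ))) i j * D j i).re =
      l j * Complex.normSq (D i j) := by
    intro j
    rw [mul_diagonal, ← hDh.apply j i, Complex.star_def,
      show D i j * (l j : ℂ) * (starRingEnd ℂ) (D i j) = l j * (D i j * (starRingEnd ℂ) (D i j)) by
        ring, Complex.mul_conj, ← Complex.ofReal_mul, Complex.ofReal_re]
  simp only [hterm]
  refine le_trans ?_ (Finset.single_le_sum (f := fun j => l j * Complex.normSq (D i j))
    (fun j _ => mul_nonneg (hl j).le (Complex.normSq_nonneg _)) (Finset.mem_univ i))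
  have hDi : D i i = ((l i)⁻¹ : ℝ) * δ i i := by
    rw [hD, weighted, of_apply, buresWeight]
    congr 2
    field_simp; norm_num
  have hn : (δ i i).re ^ 2 ≤ Complex.normSq (δ i i) := by
    rw [Complex.normSq_apply]; nlinarith [mul_self_nonneg (δ i i).im]
  have := hl i
  rw [hDi, Complex.normSq_mul, Complex.normSq_ofReal]
  calc (δ i i).re ^ 2 / l i ≤ Complex.normSq (δ i i) / l i := by gcongr
    _ = _ := by field_simp

end BuresWeights

end

/-! ### Variance and fidelity bounds for a regularized comparison -/

section

variable {ι : Type*} [Fintype ι] [DecidableEq ι]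

/-- The situation of a state `r` compared with a diagonal state `l` whose spectrum is shifted up by
`η`, together with the Bures-weighted difference `D`. -/
structure DiagonalComparison (η : ℝ) (l : ι → ℝ) (r δ D : Matrix ι ι ℂ) : Prop where
  eta_pos : 0 < η
  nonneg : ∀ i, 0 ≤ l i
  isState : IsState r
  delta_eq : δ = r - diagonal fun i => (l i : ℂ)
  weighted_eq : D = weighted (fun i j => (buresWeight (fun i => l i + η) i j : ℂ)) δ

namespace DiagonalComparison

variable {η : ℝ} {l : ι → ℝ} {r δ D : Matrix ι ι ℂ}

theorem shift_pos (h : DiagonalComparison η l r δ D) (i : ι) : 0 < l i + η :=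
  add_pos_of_nonneg_of_pos (h.nonneg i) h.eta_pos

theorem isHermitian_delta (h : DiagonalComparison η l r δ D) : δ.IsHermitian := by
  rw [h.delta_eq]
  refine h.isState.posSemidef.1.sub ?_
  rw [isHermitian_diagonal_iff]
  intro i
  exact Complex.conj_ofReal _

theorem isHermitian (h : DiagonalComparison η l r δ D) : D.IsHermitian :=
  isHermitian_weighted_bures h.isHermitian_delta h.weighted_eq

theorem re_trace_diagonal_mul_sq (h : DiagonalComparison η l r δ D) :
    (diagonal (fun i => (l i : ℂ)) * (D * D)).trace.re =
      (δ * D).trace.re - η * (D * D).trace.re := by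
  have e : diagonal (fun i => ((l i + η : ℝ) : ℂ)) =
      diagonal (fun i => (l i : ℂ)) + (η : ℂ) • 1 := by
    rw [smul_one_eq_diagonal, diagonal_add]
    push_cast
    rfl
  rw [trace_mul_weighted_bures h.shift_pos h.weighted_eq, e, mul_add, add_mul, trace_add,
    Complex.add_re, mul_smul_comm, mul_one, smul_mul_assoc, trace_smul, smul_eq_mul,
    Complex.re_ofReal_mul, add_sub_cancel_right, ← mul_assoc,
    trace_mul_comm (diagonal (fun i => (l i : ℂ)) * D), mul_assoc]

theorem eta_mul_re_trace_sq_le (h : DiagonalComparison η l r δ D) :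
    η * (D * D).trace.re ≤ (δ * D).trace.re := by
  have h1 := (Complex.le_def.mp (posSemidef_mul_diagonal_mul h.nonneg h.isHermitian).trace_nonneg).1
  have h2 := h.re_trace_diagonal_mul_sq
  rw [← mul_assoc, trace_mul_comm, ← mul_assoc] at h2
  rw [h2, Complex.zero_re] at h1
  linarith

/-- The hypothesis gives `tr (D²) ≤ b²`, hence `D ≤ b`. Split `r` into its diagonal reference and
`δ`: the first contributes at most `s = tr (δ D)`, the second is `tr (D Λ D · D) ≤ b s` with `Λ` the
shifted diagonal. -/
theorem re_trace_mul_sq_le (h : DiagonalComparison η l r δ D) {b : ℝ} (hb : 0 < b)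
    (hle : (δ * D).trace.re ≤ η * b ^ 2) :
    (r * (D * D)).trace.re ≤ (δ * D).trace.re * (1 + b) := by
  have hη := h.eta_pos
  have hDD : 0 ≤ (D * D).trace.re := by
    have := re_trace_conjTranspose_mul_self_nonneg D
    rwa [h.isHermitian.eq] at this
  have hDb : D ≤ (b : ℂ) • 1 := by
    refine le_smul_one_of_trace_mul_self_le h.isHermitian hb ?_
    have := h.eta_mul_re_trace_sq_le.trans hle
    exact le_of_mul_le_mul_left this hη
  have h1 := re_trace_mul_le_re_trace_mul
    (posSemidef_mul_diagonal_mul (fun i => (h.shift_pos i).le) h.isHermitian) hDb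
  rw [← trace_mul_weighted_bures_sq h.shift_pos h.weighted_eq, mul_smul_comm, mul_one, trace_smul,
    smul_eq_mul, Complex.re_ofReal_mul, ← trace_mul_weighted_bures h.shift_pos h.weighted_eq] at h1
  have hr : r = diagonal (fun i => (l i : ℂ)) + δ := by rw [h.delta_eq]; abel
  have h2 : (r * (D * D)).trace.re = (diagonal (fun i => (l i : ℂ)) * (D * D)).trace.re +
      (δ * (D * D)).trace.re := by
    conv_lhs => rw [hr]
    rw [add_mul, trace_add, Complex.add_re]
  have h3 := h.re_trace_diagonal_mul_sq
  nlinarith [mul_nonneg hη.le hDD]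

/-- After decoupling the kernel, the sum is at most `(∑ r i i / (l i + η))² ≤ (d + y)²`, where `y`
collects the diagonal of `δ` and Cauchy–Schwarz gives `y² ≤ (d/η) tr (δ D)`. -/
theorem sum_weight_sq_le (h : DiagonalComparison η l r δ D) :
    (∑ i, ∑ j, (buresWeight (fun i => l i + η) i j : ℂ) ^ 2 * (r i i * r j j)).re ≤
      2 * (Fintype.card ι : ℝ) ^ 2 + 2 * (Fintype.card ι / η) * (δ * D).trace.re := by
  have hη := h.eta_pos
  set L : ι → ℝ := fun i => l i + η with hL
  have hLpos : ∀ i, 0 < L i := h.shift_pos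
  have ha : ∀ i, r i i = (((r i i).re : ℝ) : ℂ) ∧ 0 ≤ (r i i).re := by
    intro i
    have := Complex.le_def.mp (h.isState.posSemidef.diag_nonneg (i := i))
    exact ⟨Complex.ext (by simp) (by simpa using this.2.symm), this.1⟩
  have hδ : ∀ i, (r i i).re = l i + (δ i i).re := by
    intro i; rw [h.delta_eq]; simp
  have h1 : (∑ i, ∑ j, (buresWeight L i j : ℂ) ^ 2 * (r i i * r j j)).re =
      ∑ i, ∑ j, buresWeight L i j ^ 2 * ((r i i).re * (r j j).re) := by
    rw [← Complex.ofReal_re (∑ i, ∑ j, buresWeight L i j ^ 2 * ((r i i).re * (r j j).re))]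
    congr 1
    push_cast
    refine Finset.sum_congr rfl fun i _ => Finset.sum_congr rfl fun j _ => ?_
    rw [← (ha i).1, ← (ha j).1]
  have h2 : ∑ i, ∑ j, buresWeight L i j ^ 2 * ((r i i).re * (r j j).re) ≤
      (∑ i, (r i i).re / L i) ^ 2 := by
    rw [pow_two, Finset.sum_mul_sum]
    refine Finset.sum_le_sum fun i _ => Finset.sum_le_sum fun j _ => ?_
    calc buresWeight L i j ^ 2 * ((r i i).re * (r j j).re)
        ≤ ((L i)⁻¹ * (L j)⁻¹) * ((r i i).re * (r j j).re) :=
          mul_le_mul_of_nonneg_right (buresWeight_sq_le hLpos i j)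
            (mul_nonneg (ha i).2 (ha j).2)
      _ = _ := by ring
  set y := ∑ i, (δ i i).re / L i with hy
  have h3 : ∑ i, (r i i).re / L i ≤ Fintype.card ι + y := by
    have : (Fintype.card ι : ℝ) = ∑ _i : ι, (1 : ℝ) := by simp
    rw [this, hy, ← Finset.sum_add_distrib]
    refine Finset.sum_le_sum fun i _ => ?_
    have := hLpos i
    rw [hδ, add_div]
    gcongr
    rw [div_le_one this, hL]
    linarith
  have h4 : 0 ≤ ∑ i, (r i i).re / L i :=
    Finset.sum_nonneg fun i _ => div_nonneg (ha i).2 (hLpos i).le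
  have h5 : y ^ 2 ≤ (Fintype.card ι / η) * (δ * D).trace.re := by
    calc y ^ 2 ≤ Fintype.card ι * ∑ i, ((δ i i).re / L i) ^ 2 := by
          simpa using sq_sum_le_card_mul_sum_sq (s := Finset.univ) (f := fun i => (δ i i).re / L i)
      _ ≤ Fintype.card ι * ∑ i, (1 / η) * ((δ i i).re ^ 2 / L i) := by
          gcongr with i
          have hi := hLpos i
          have hle : η ≤ L i := by rw [hL]; linarith [h.nonneg i]
          calc ((δ i i).re / L i) ^ 2 = (1 / L i) * ((δ i i).re ^ 2 / L i) := by field_simp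
            _ ≤ _ := by gcongr
      _ = (Fintype.card ι / η) * ∑ i, (δ i i).re ^ 2 / L i := by
          rw [← Finset.mul_sum]; ring
      _ ≤ _ := mul_le_mul_of_nonneg_left
          (sum_div_sq_le hLpos h.isHermitian_delta h.weighted_eq) (by positivity)
  rw [h1]
  nlinarith [sq_nonneg ((Fintype.card ι : ℝ) - y), pow_le_pow_left₀ h4 h3 2]

/-- The variance of the normalized distance observable. -/
theorem variance_le (h : DiagonalComparison η l r δ D) {ρ U : Matrix ι ι ℂ} (hρ : IsState ρ)
    (hU : Uᴴ * U = 1) (hr : r = Uᴴ * ρ * U) {m : ℕ} (hm : 0 < m)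
    {H : Matrix (Fin (m + m) → ι) (Fin (m + m) → ι) ℂ}
    (hH : H = ((m : ℂ) ^ 2)⁻¹ • distanceOp m (buresWeight fun i => l i + η) U l) :
    (copies (m + m) ρ * ((H - ((δ * D).trace.re : ℂ) • 1) *
      (H - ((δ * D).trace.re : ℂ) • 1))).trace.re ≤
      (2 * (Fintype.card ι : ℝ) ^ 2 + 2 * (Fintype.card ι / η) * (δ * D).trace.re) / m ^ 2 +
        2 / m * (r * (D * D)).trace.re := by
  have hm0 : (m : ℂ) ≠ 0 := by exact_mod_cast hm.ne'
  have hmr : (0 : ℝ) < m := by exact_mod_cast hm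
  have htr := hρ.trace_eq_one
  set c := buresWeight fun i => l i + η with hc
  set K := weighted (fun i j => (c i j : ℂ)) r with hK
  set T := ∑ i, ∑ j, (c i j : ℂ) ^ 2 * (r i i * r j j) with hT
  have hreal : ∀ {A B : Matrix ι ι ℂ}, A.IsHermitian → B.IsHermitian →
      (A * B).trace = (((A * B).trace.re : ℝ) : ℂ) := fun hA hB =>
    Complex.ext (by simp) (by simpa using im_trace_mul_eq_zero hA hB)
  have hrh := h.isState.posSemidef.1
  have hKh : K.IsHermitian := isHermitian_weighted_bures hrh hK
  have hDh := h.isHermitian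
  have e1 : (copies (m + m) ρ * H).trace.re = (δ * D).trace.re := by
    rw [hH, mul_smul_comm, trace_smul, trace_copies_mul_distanceOp htr c U l hr h.delta_eq,
      ← h.weighted_eq, smul_eq_mul, inv_mul_cancel_left₀ (pow_ne_zero 2 hm0)]
  have e2 : (copies (m + m) ρ * (H * H)).trace =
      ((m : ℂ) ^ 2)⁻¹ * (T - 2 * (r * (K * K)).trace + (r * K).trace ^ 2)
      + 2 * (m : ℂ)⁻¹ * ((r * (D * D)).trace - (r * D).trace ^ 2) + (δ * D).trace ^ 2 := by
    rw [hH, smul_mul_smul_comm, mul_smul_comm, trace_smul,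
      trace_copies_mul_distanceOp_sq htr hU (buresWeight_comm _) l hr h.delta_eq hK h.weighted_eq,
      smul_eq_mul, show ∑ i, ∑ j, (buresWeight (fun i => l i + η) i j : ℂ) ^ 2 * (r i i * r j j) = T
        from rfl]
    field_simp
  have e3 : (copies (m + m) ρ * (H * H)).trace.re =
      ((m : ℝ) ^ 2)⁻¹ * (T.re - 2 * (r * (K * K)).trace.re + (r * K).trace.re ^ 2)
      + 2 * (m : ℝ)⁻¹ * ((r * (D * D)).trace.re - (r * D).trace.re ^ 2)
      + (δ * D).trace.re ^ 2 := by
    rw [e2, hreal hrh hKh, hreal hrh hDh, hreal h.isHermitian_delta hDh]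
    have c1 : ((m : ℂ) ^ 2)⁻¹ = ((((m : ℝ) ^ 2)⁻¹ : ℝ) : ℂ) := by push_cast; rfl
    have c2 : 2 * (m : ℂ)⁻¹ = ((2 * (m : ℝ)⁻¹ : ℝ) : ℂ) := by push_cast; rfl
    rw [c1, c2]
    simp only [Complex.add_re, Complex.sub_re, Complex.re_ofReal_mul, ← Complex.ofReal_pow,
      Complex.ofReal_re]
    rw [show (2 : ℂ) = ((2 : ℝ) : ℂ) by norm_num, Complex.re_ofReal_mul]
  rw [re_trace_mul_sub_sq (isState_copies hρ).trace_eq_one, e1, e3]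
  -- This lets the nonpositive `K` terms be discarded, so only the diagonal sum `T` survives at
  -- order `m⁻²`.
  have k1 := sq_re_trace_mul_le h.isState hKh
  have k2 := h.sum_weight_sq_le
  have k3 : ((m : ℝ) ^ 2)⁻¹ * (T.re - 2 * (r * (K * K)).trace.re + (r * K).trace.re ^ 2) ≤
      ((m : ℝ) ^ 2)⁻¹ *
        (2 * (Fintype.card ι : ℝ) ^ 2 + 2 * (Fintype.card ι / η) * (δ * D).trace.re) := by
    refine mul_le_mul_of_nonneg_left ?_ (by positivity)
    nlinarith [sq_nonneg (r * K).trace.re]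
  have k4 : 2 * (m : ℝ)⁻¹ * ((r * (D * D)).trace.re - (r * D).trace.re ^ 2) ≤
      2 * (m : ℝ)⁻¹ * (r * (D * D)).trace.re :=
    mul_le_mul_of_nonneg_left (by nlinarith [sq_nonneg (r * D).trace.re]) (by positivity)
  calc _ ≤ ((m : ℝ) ^ 2)⁻¹ *
        (2 * (Fintype.card ι : ℝ) ^ 2 + 2 * (Fintype.card ι / η) * (δ * D).trace.re) +
        2 * (m : ℝ)⁻¹ * (r * (D * D)).trace.re := by linarith
    _ = _ := by ring

theorem one_sub_fidelity_le (h : DiagonalComparison η l r δ D) {ρ σ U : Matrix ι ι ℂ}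
    (hρ : IsState ρ) (hσ : IsState σ) (hU : Uᴴ * U = 1) (hU' : U * Uᴴ = 1)
    (hr : r = Uᴴ * ρ * U) (hl : σ = U * diagonal (fun i => (l i : ℂ)) * Uᴴ) :
    1 - fidelity ρ σ ≤ 3 * (η * Fintype.card ι + (δ * D).trace.re / 4) := by
  set Λ := diagonal (fun i => ((l i + η : ℝ) : ℂ)) with hΛ
  have hτ : σ + (η : ℂ) • 1 = U * Λ * Uᴴ := by
    have e : Λ = diagonal (fun i => (l i : ℂ)) + (η : ℂ) • 1 := by
      rw [smul_one_eq_diagonal, diagonal_add, hΛ]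
      push_cast
      rfl
    rw [e, mul_add, add_mul, ← hl, mul_smul_comm, mul_one, smul_mul_assoc, hU']
  have conj_mul : ∀ A B : Matrix ι ι ℂ, U * A * Uᴴ * (U * B * Uᴴ) = U * (A * B) * Uᴴ := by
    intro A B
    calc _ = U * A * (Uᴴ * U) * B * Uᴴ := by simp only [mul_assoc]
      _ = _ := by rw [hU, mul_one]; simp only [mul_assoc]
  -- The factor `1/2` cancels the 2 in the anticommutator identity; squared, it produces the `1/4`
  -- in the bound.
  set G := U * ((2⁻¹ : ℂ) • D) * Uᴴ with hG
  have hGh : G.IsHermitian := by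
    have h2 : ((2⁻¹ : ℂ) • D).IsHermitian := by
      rw [IsHermitian, conjTranspose_smul, h.isHermitian.eq]
      simp
    exact isHermitian_mul_mul_conjTranspose U h2
  have hρU : U * r * Uᴴ = ρ := by
    rw [hr]
    calc _ = (U * Uᴴ) * ρ * (U * Uᴴ) := by simp only [mul_assoc]
      _ = ρ := by rw [hU', one_mul, mul_one]
  have hanti : G * (σ + (η : ℂ) • 1) + (σ + (η : ℂ) • 1) * G = ρ - σ := by
    rw [hτ, hG, conj_mul, conj_mul, ← add_mul, ← mul_add, smul_mul_assoc, mul_smul_comm,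
      ← smul_add, weighted_bures_anticomm h.shift_pos h.weighted_eq, smul_smul,
      inv_mul_cancel₀ two_ne_zero, one_smul, h.delta_eq, mul_sub, sub_mul, hρU, ← hl]
  have htr : (G * (σ + (η : ℂ) • 1) * G).trace.re = (δ * D).trace.re / 4 := by
    rw [hτ, hG, conj_mul, conj_mul, trace_mul_comm, ← mul_assoc, hU, one_mul, smul_mul_assoc,
      smul_mul_assoc, mul_smul_comm, smul_smul, trace_smul,
      ← trace_mul_weighted_bures h.shift_pos h.weighted_eq, smul_eq_mul,
      show (2⁻¹ * 2⁻¹ : ℂ) = ((4⁻¹ : ℝ) : ℂ) by norm_num, Complex.re_ofReal_mul]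
    ring
  have := QuantumCert.one_sub_fidelity_le hρ hσ h.eta_pos hGh hanti
  rwa [htr] at this

end DiagonalComparison

end

/-! ### Spectral data of the known state and the tester -/

section

variable {ι : Type*} [Fintype ι] [DecidableEq ι]

theorem IsState.exists_spectral {σ : Matrix ι ι ℂ} (hσ : IsState σ) :
    ∃ (U : Matrix ι ι ℂ) (l : ι → ℝ), Uᴴ * U = 1 ∧ U * Uᴴ = 1 ∧ (∀ i, 0 ≤ l i) ∧
      σ = U * diagonal (fun i => (l i : ℂ)) * Uᴴ := by
  have hP := hσ.posSemidef.1
  refine ⟨hP.eigenvectorUnitary.1, hP.eigenvalues, ?_, ?_, hσ.posSemidef.eigenvalues_nonneg, ?_⟩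
  · rw [← star_eq_conjTranspose]; exact (Matrix.mem_unitaryGroup_iff').mp hP.eigenvectorUnitary.2
  · rw [← star_eq_conjTranspose]; exact (Matrix.mem_unitaryGroup_iff).mp hP.eigenvectorUnitary.2
  · have := hP.spectral_theorem
    rw [Unitary.conjStarAlgAut_apply] at this
    conv_lhs => rw [this]
    rfl

theorem IsState.conj {ρ U : Matrix ι ι ℂ} (hρ : IsState ρ) (hU : U * Uᴴ = 1) :
    IsState (Uᴴ * ρ * U) :=
  ⟨hρ.posSemidef.conjTranspose_mul_mul_same U, by
    rw [trace_mul_comm, ← mul_assoc, hU, one_mul, hρ.trace_eq_one]⟩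

/-- The measurement that ignores the state and always reports `true`. -/
def alwaysTrue (ι : Type*) [Fintype ι] [DecidableEq ι] : POVM Bool ι where
  op k := if k then 1 else 0
  posSemidef k := by cases k <;> simp [PosSemidef.one, PosSemidef.zero]
  sum_eq_one := by simp

theorem prob_alwaysTrue {R : Matrix ι ι ℂ} (hR : R.trace = 1) :
    (alwaysTrue ι).prob R true = 1 := by
  simp [POVM.prob, alwaysTrue, hR]

end

/-- The spectral test of the distance observable distinguishes the two cases once the number of
copies in each half is at least `200 d / ε`. -/
theorem exists_tester {d : ℕ} (hd : 0 < d) {ε : ℝ} (hε : 0 < ε) {m : ℕ}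
    (hm : 200 * ((d : ℝ) / ε) ≤ m) {σ : Matrix (Fin d) (Fin d) ℂ} (hσ : IsState σ) :
    ∃ T : Tester (m + m) d, ∀ ρ : Matrix (Fin d) (Fin d) ℂ, IsState ρ →
      (ρ = σ → 2 / 3 ≤ T.prob (copies (m + m) ρ) true) ∧
      (fidelity ρ σ < 1 - ε → 2 / 3 ≤ T.prob (copies (m + m) ρ) false) := by
  obtain ⟨U, l, hU, hU', hl0, hl⟩ := hσ.exists_spectral
  have hd1 : (1 : ℝ) ≤ d := by exact_mod_cast hd
  have hd0 : (0 : ℝ) < d := by linarith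
  have hmr : (0 : ℝ) < m := lt_of_lt_of_le (by positivity) hm
  have hm0 : 0 < m := by exact_mod_cast hmr
  have hq : (d : ℝ) / m ≤ ε / 200 := by
    rw [div_le_div_iff₀ hmr (by norm_num)]
    have := mul_le_mul_of_nonneg_left hm hε.le
    field_simp at this
    linarith
  have hq0 : 0 ≤ (d : ℝ) / m := by positivity
  -- This choice makes the regularization cost `3 η d` equal to `ε / 2`, leaving `s ≥ 2ε/3` in the
  -- far case.
  set η : ℝ := ε / (6 * d) with hη
  have hη0 : 0 < η := by positivity
  set H : Matrix (Fin (m + m) → Fin d) (Fin (m + m) → Fin d) ℂ :=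
    ((m : ℂ) ^ 2)⁻¹ • distanceOp m (buresWeight fun i => l i + η) U l with hH
  have hHh : H.IsHermitian := by
    rw [IsHermitian, hH, conjTranspose_smul, (isHermitian_distanceOp m (buresWeight_comm _) U l).eq]
    simp
  -- The threshold lies halfway between `0` and `2ε/3`, so a far state is misjudged only by a
  -- deviation of at least `s / 2`.
  refine ⟨thresholdPOVM H hHh (ε / 3), fun ρ hρ => ?_⟩
  obtain ⟨r, hr⟩ : ∃ r, r = Uᴴ * ρ * U := ⟨_, rfl⟩
  obtain ⟨δ, hδ⟩ : ∃ δ, δ = r - diagonal fun i => (l i : ℂ) := ⟨_, rfl⟩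
  obtain ⟨D, hD⟩ : ∃ D, D = weighted (fun i j => (buresWeight (fun i => l i + η) i j : ℂ)) δ :=
    ⟨_, rfl⟩
  have comp : DiagonalComparison η l r δ D :=
    ⟨hη0, hl0, hr ▸ hρ.conj hU', hδ, hD⟩
  have hvar := comp.variance_le hρ hU hr hm0 hH
  have hsum := prob_true_add_prob_false (thresholdPOVM H hHh (ε / 3))
    (isState_copies (n := m + m) hρ).trace_eq_one
  have hpos := (isState_copies (n := m + m) hρ).posSemidef
  set s := (δ * D).trace.re with hs
  have hdη : (d : ℝ) / η = 6 * d ^ 2 / ε := by rw [hη]; field_simp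
  rw [Fintype.card_fin, hdη] at hvar
  constructor
  · intro hρσ
    have hδ0 : δ = 0 := by
      rw [hδ, hr, hρσ, hl]
      have : Uᴴ * (U * diagonal (fun i => (l i : ℂ)) * Uᴴ) * U =
          (Uᴴ * U) * diagonal (fun i => (l i : ℂ)) * (Uᴴ * U) := by simp only [mul_assoc]
      rw [this, hU, one_mul, mul_one, sub_self]
    have hD0 : D = 0 := by
      rw [hD, hδ0]; ext i j; simp [weighted]
    have hs0 : s = 0 := by rw [hs, hδ0]; simp
    have hcheb := prob_thresholdPOVM_mul_le hpos hHh (t := ε / 3) (s := s) (a := (ε / 3) ^ 2) false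
      (fun x hx => by
        have : ε / 3 ≤ x := by simpa using hx
        rw [hs0, sub_zero]
        gcongr)
    have hfin := hcheb.trans hvar
    rw [hs0, hD0] at hfin
    have hb : 2 * ((d : ℝ) / m) ^ 2 ≤ 2 * (ε / 200) ^ 2 := by gcongr
    have e : (2 * (d : ℝ) ^ 2 + 2 * (6 * (d : ℝ) ^ 2 / ε) * 0) / (m : ℝ) ^ 2 +
        2 / m * (r * ((0 : Matrix (Fin d) (Fin d) ℂ) * 0)).trace.re = 2 * ((d : ℝ) / m) ^ 2 := by
      simp; ring
    rw [e] at hfin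
    have h3 : (thresholdPOVM H hHh (ε / 3)).prob (copies (m + m) ρ) false ≤ 1 / 3 := by
      by_contra! hlt
      nlinarith [mul_lt_mul_of_pos_right hlt (show 0 < (ε / 3) ^ 2 by positivity), sq_pos_of_pos hε]
    linarith
  · intro hF
    have hfid := comp.one_sub_fidelity_le hρ hσ hU hU' hr hl
    rw [Fintype.card_fin, show η * (d : ℝ) = ε / 6 by rw [hη]; field_simp, ← hs] at hfid
    have hsε : 2 * ε / 3 ≤ s := by linarith
    have hs0 : 0 < s := by linarith
    have hcheb := prob_thresholdPOVM_mul_le hpos hHh (t := ε / 3) (s := s) (a := (s / 2) ^ 2) true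
      (fun x hx => by
        have : x < ε / 3 := by simpa using hx
        nlinarith)
    -- The natural bound on `D` is `√(s/η) = √(6ds/ε)`; since `s ≥ 2ε/3` and `d ≥ 1`, this `b`
    -- dominates it without a square root.
    have hb := comp.re_trace_mul_sq_le (b := 3 * d * s / ε) (by positivity) (by
      rw [← hs, hη]
      have e : ε / (6 * (d : ℝ)) * (3 * d * s / ε) ^ 2 = s * (3 / 2 * d * (s / ε)) := by
        field_simp; norm_num
      rw [e]
      have h1 : 2 / 3 ≤ s / ε := by rw [div_le_div_iff₀ (by norm_num) hε]; linarith
      have h2 : 1 ≤ 3 / 2 * d * (s / ε) := by nlinarith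
      exact le_mul_of_one_le_right hs0.le h2)
    rw [← hs] at hb
    have hfin := hcheb.trans hvar
    have hm1 : 1 / (m : ℝ) ≤ (d : ℝ) / m := by gcongr
    have t1 : 2 * ((d : ℝ) / m) ^ 2 ≤ 2 * (ε / 200) ^ 2 := by gcongr
    have t2 : 12 * ((d : ℝ) / m) ^ 2 * (s / ε) ≤ 12 * (ε / 200) ^ 2 * (s / ε) := by gcongr
    have t3 : 2 * (1 / (m : ℝ)) * s ≤ 2 * (ε / 200) * s :=
      mul_le_mul_of_nonneg_right (by linarith) hs0.le
    have t4 : 6 * ((d : ℝ) / m) * (s ^ 2 / ε) ≤ 6 * (ε / 200) * (s ^ 2 / ε) := by gcongr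
    have e2 : 12 * (ε / 200) ^ 2 * (s / ε) = 12 / 40000 * (ε * s) := by field_simp; norm_num
    have e4 : 6 * (ε / 200) * (s ^ 2 / ε) = 6 / 200 * s ^ 2 := by field_simp
    have hb' : 2 / (m : ℝ) * (r * (D * D)).trace.re ≤
        2 * (1 / (m : ℝ)) * s + 6 * ((d : ℝ) / m) * (s ^ 2 / ε) := by
      calc _ ≤ 2 / (m : ℝ) * (s * (1 + 3 * d * s / ε)) := by gcongr
        _ = _ := by ring
    have e1 : (2 * (d : ℝ) ^ 2 + 2 * (6 * (d : ℝ) ^ 2 / ε) * s) / (m : ℝ) ^ 2 =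
        2 * ((d : ℝ) / m) ^ 2 + 12 * ((d : ℝ) / m) ^ 2 * (s / ε) := by ring
    have hes : ε * s ≤ 3 / 2 * s ^ 2 := by
      calc ε * s ≤ 3 / 2 * s * s := mul_le_mul_of_nonneg_right (by linarith) hs0.le
        _ = _ := by ring
    have hee : ε ^ 2 ≤ 9 / 4 * s ^ 2 := by
      calc ε ^ 2 ≤ (3 / 2 * s) ^ 2 := by gcongr; linarith
        _ = _ := by ring
    -- With `ε ≤ 3s/2`, all four variance terms are small multiples of `s²`; `1/12` is exactly a
    -- third of the `1/4` on the left.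
    have htot : (thresholdPOVM H hHh (ε / 3)).prob (copies (m + m) ρ) true * (s / 2) ^ 2 ≤
        1 / 12 * s ^ 2 := by
      rw [e1] at hfin
      have := sq_nonneg s
      linarith
    have h3 : (thresholdPOVM H hHh (ε / 3)).prob (copies (m + m) ρ) true ≤ 1 / 3 := by
      by_contra! hlt
      have := mul_lt_mul_of_pos_right hlt (show 0 < (s / 2) ^ 2 by positivity)
      linarith
    linarith

end QuantumCert

end

theorem corollary2 :
    ∃ C : ℝ, 0 < C ∧ ∀ (d : ℕ) (ε : ℝ), 0 < ε →
      ∃ n : ℕ, (n : ℝ) ≤ C * ((d : ℝ) / ε) ∧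
        ∀ σ : Matrix (Fin d) (Fin d) ℂ, QuantumCert.IsState σ →
          ∃ T : QuantumCert.Tester n d,
            ∀ ρ : Matrix (Fin d) (Fin d) ℂ, QuantumCert.IsState ρ →
              (ρ = σ → 2 / 3 ≤ T.prob (QuantumCert.copies n ρ) true) ∧
              (QuantumCert.fidelity ρ σ < 1 - ε →
                2 / 3 ≤ T.prob (QuantumCert.copies n ρ) false) := by
  -- Two blocks of `⌈200 d/ε⌉` copies; as `d/ε ≥ 1` in the main case, rounding costs at most `d/ε`
  -- per block, giving `2 (200 + 1)`.
  refine ⟨402, by norm_num, fun d ε hε => ?_⟩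
  by_cases h : 0 < d ∧ ε < 1
  · obtain ⟨hd, hε1⟩ := h
    refine ⟨⌈200 * ((d : ℝ) / ε)⌉₊ + ⌈200 * ((d : ℝ) / ε)⌉₊, ?_, fun σ hσ =>
      QuantumCert.exists_tester hd hε (Nat.le_ceil _) hσ⟩
    have h1 : (1 : ℝ) ≤ d / ε := by
      rw [one_le_div hε]
      have : (1 : ℝ) ≤ d := by exact_mod_cast hd
      linarith
    have h2 := Nat.ceil_lt_add_one (show (0 : ℝ) ≤ 200 * (d / ε) by positivity)
    push_cast
    linarith
  -- No copies are needed: for `d = 0` there are no states, and for `ε ≥ 1` nonnegativity of the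
  -- fidelity makes the far case empty.
  · refine ⟨0, by simp only [Nat.cast_zero]; positivity, fun σ _ =>
      ⟨QuantumCert.alwaysTrue _, fun ρ hρ => ⟨fun _ => ?_, fun hF => ?_⟩⟩⟩
    · rw [QuantumCert.prob_alwaysTrue (QuantumCert.isState_copies hρ).trace_eq_one]
      norm_num
    · rcases Nat.eq_zero_or_pos d with rfl | hd
      · have := hρ.trace_eq_one
        simp at this
      · have hε1 : 1 ≤ ε := not_lt.mp fun h' => h ⟨hd, h'⟩
        have hF0 : 0 ≤ QuantumCert.fidelity ρ σ := QuantumCert.traceNorm_nonneg _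
        linarith
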